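/- Jobs $k\in\{1,2,\dots\}$ with arrival time $a_k$, service demand $\sigma_k$ and sojourn time $\tau_k$ form an independently marked stationary Poisson point process $\{(a_k;\sigma_k,\tau_k)\}$ on $[0,\infty)\times\mathbb R^2$ with intensity measure $\Lambda\,da\,f(d\sigma,d\tau)$, where $\Lambda>0$ and $f$ is a probability law with $0\le\sigma\le\tau$ almost surely and with finite first and second moments. Job $k$ is served at the locally integrable rate $r_k(t)\ge 0$, with $r_k(t)=0$ for $t<a_k$. Let $y_k(t)=\sigma_k-\int_{a_k}^t r_k(s)\,ds$ and $x_k(t)=a_k+\tau_k-t$ be its remaining demand and remaining time at $t\ge a_k$. Suppose that the rates are set by a centralized online policy, that is, $r_k(t)=u(k,t,A_t)$ for all $k$ and all $t \ge 0$, where $u$ is a deterministic map and $A_t=\{(a_k,\sigma_k,\tau_k,y_k(t),x_k(t)): a_k\le t\}$ (recorded together with the labels $k$), and the rates do not anticipate: $r_k(t)$ is determined, up to null sets, by the arrivals up to time $t$. (Neither an upper bound on the rates nor the demand and deadline constraints are imposed.) Let $P(t)=\sum_k r_k(t)$ be the service capacity and $X(t)=\sum_{k:\,a_k\le t}y_k(t)$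 the total remaining demand. For a process $Y$ call $\mathrm{Var}(Y)=\lim_{T\to\infty}\frac1T\int_0^T\mathrm{Var}(Y(t))\,dt\in[0,\infty]$ its stationary variance, and assume that this limit exists for $X$ and for $P$. If $\mathrm{Var}(X)\le D$ for some real $D>0$, then $$\mathrm{Var}(P)\ \ge\ \frac{\Lambda^2\,\mathbb E[\sigma^2]^2}{4D}.$$ -/

import Mathlib

open MeasureTheory ProbabilityTheory Filter
open scoped ENNReal NNReal Topology

namespace DeadlineScheduling

/-! A job is a point `(a, σ, τ)` of `ℝ × ℝ × ℝ`: its arrival time, service demand and sojourn time.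
The random sequence of jobs is `job : ℕ → Ω → ℝ × ℝ × ℝ`, and `r k t ω` is the service rate of
job `k` at time `t`. -/

section

variable {Ω : Type*} [MeasurableSpace Ω]

/-- The point process of the jobs: the counting measure `∑ₖ δ_(aₖ, σₖ, τₖ)`. -/
noncomputable def jobProcess (job : ℕ → Ω → ℝ × ℝ × ℝ) (ω : Ω) : Measure (ℝ × ℝ × ℝ) :=
  Measure.sum fun k => Measure.dirac (job k ω)

/-- The intensity measure `Λ da f(dσ, dτ)` on `[0, ∞) × ℝ²` of stationary arrivals with rate `Λ`
and joint law `f` of demand and sojourn time. -/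
noncomputable def arrivalIntensity (Λ : ℝ≥0) (f : Measure (ℝ × ℝ)) : Measure (ℝ × ℝ × ℝ) :=
  Λ • (((volume : Measure ℝ).restrict (Set.Ici 0)).prod f)

/-- The jobs form an independently marked, stationary Poisson point process on `[0, ∞)`, that is,
a Poisson point process with intensity measure `Λ da f(dσ, dτ)`: the number of jobs in a set of
finite intensity is Poisson distributed with the intensity of the set as its mean, and the numbers
of jobs in disjoint sets are independent. -/
structure IsPoissonArrivals (μ : Measure Ω) (Λ : ℝ≥0) (f : Measure (ℝ × ℝ))
    (job : ℕ → Ω → ℝ × ℝ × ℝ) : Prop where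
  measurable_job : ∀ k, Measurable (job k)
  hasLaw_count : ∀ B : Set (ℝ × ℝ × ℝ), MeasurableSet B → arrivalIntensity Λ f B ≠ ∞ →
    HasLaw (fun ω => jobProcess job ω B)
      ((poissonMeasure (arrivalIntensity Λ f B).toNNReal).map (fun n : ℕ => (n : ℝ≥0∞))) μ
  indep_count : ∀ (n : ℕ) (B : Fin n → Set (ℝ × ℝ × ℝ)), (∀ i, MeasurableSet (B i)) →
    Pairwise (fun i j => Disjoint (B i) (B j)) →
    iIndepFun (fun i ω => jobProcess job ω (B i)) μ

/-- The σ-algebra of the arrivals up to time `t`, generated by the numbers of jobs in the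
measurable subsets of `(-∞, t] × ℝ²`. -/
noncomputable abbrev history (job : ℕ → Ω → ℝ × ℝ × ℝ) (t : ℝ) : MeasurableSpace Ω :=
  ⨆ (B : Set (ℝ × ℝ × ℝ)) (_ : MeasurableSet B),
    MeasurableSpace.comap (fun ω => jobProcess job ω (B ∩ {p | p.1 ≤ t})) inferInstance

/-- The remaining demand `yₖ(t) = σₖ - ∫_{aₖ}^t rₖ(s) ds` of job `k`, for `t ≥ aₖ`. -/
noncomputable def remainingDemand (job : ℕ → Ω → ℝ × ℝ × ℝ) (r : ℕ → ℝ → Ω → ℝ)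
    (k : ℕ) (t : ℝ) (ω : Ω) : ℝ :=
  (job k ω).2.1 - ∫ s in (job k ω).1..t, r k s ω

/-- The remaining time `xₖ(t) = aₖ + τₖ - t` of job `k`. -/
def remainingTime (job : ℕ → Ω → ℝ × ℝ × ℝ) (k : ℕ) (t : ℝ) (ω : Ω) : ℝ :=
  (job k ω).1 + (job k ω).2.2 - t

/-- What the scheduler knows about a job that has arrived. -/
structure JobRecord where
  arrivalTime : ℝ
  demand : ℝ
  sojournTime : ℝ
  remainingDemand : ℝ
  remainingTime : ℝ

/-- The information `A_t`: the (labelled) records `(aₖ, σₖ, τₖ, yₖ(t), xₖ(t))` of all jobs `k` with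
`aₖ ≤ t`. -/
def information (job : ℕ → Ω → ℝ × ℝ × ℝ) (r : ℕ → ℝ → Ω → ℝ) (t : ℝ) (ω : Ω) :
    Set (ℕ × JobRecord) :=
  {q | ∃ k, (job k ω).1 ≤ t ∧
    q = (k, ⟨(job k ω).1, (job k ω).2.1, (job k ω).2.2,
      remainingDemand job r k t ω, remainingTime job k t ω⟩)}

/-- The service rates `r` are those of the centralized online policy `u`: nonnegative, locally
integrable in time, zero before the arrival of the job, and given by `rₖ(t) = u(k, t, A_t)`. Since
the record `A_t` contains the remaining demands, which depend on the rates before `t`, this last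
condition is a feedback equation for the rates, which may have several solutions; `online` says that
the realized rates do not anticipate, i.e. that (up to null sets) they are determined by the
arrivals up to time `t`. No upper bound on the rates, and no demand or deadline constraint,
is imposed. -/
structure IsCentralizedPolicy (μ : Measure Ω) (job : ℕ → Ω → ℝ × ℝ × ℝ)
    (u : ℕ → ℝ → Set (ℕ × JobRecord) → ℝ) (r : ℕ → ℝ → Ω → ℝ) : Prop where
  measurable_rate : ∀ k, Measurable (Function.uncurry (r k))
  nonneg : ∀ᵐ ω ∂μ, ∀ k t, 0 ≤ r k t ω
  locallyIntegrable : ∀ᵐ ω ∂μ, ∀ k, LocallyIntegrable (fun t => r k t ω)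
  eq_zero_of_lt : ∀ᵐ ω ∂μ, ∀ k t, t < (job k ω).1 → r k t ω = 0
  eq_policy : ∀ᵐ ω ∂μ, ∀ k t, 0 ≤ t → r k t ω = u k t (information job r t ω)
  online : ∀ k t, AEStronglyMeasurable[history job t] (r k t) μ

/-- The service capacity `P(t) = ∑ₖ rₖ(t)`. -/
noncomputable def serviceCapacity (r : ℕ → ℝ → Ω → ℝ) (t : ℝ) (ω : Ω) : ℝ :=
  ∑' k, r k t ω

open Classical in
/-- The total remaining demand `X(t) = ∑_{k : aₖ ≤ t} yₖ(t)`. -/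
noncomputable def totalRemainingDemand (job : ℕ → Ω → ℝ × ℝ × ℝ) (r : ℕ → ℝ → Ω → ℝ)
    (t : ℝ) (ω : Ω) : ℝ :=
  ∑' k, if (job k ω).1 ≤ t then remainingDemand job r k t ω else 0

/-- `v` is the stationary variance of the process `Y`: the long-run time average
`lim_{T → ∞} (1/T) ∫₀ᵀ Var(Y(t)) dt` exists and equals `v`. The variance of a random variable that
is not square integrable is `∞`. -/
def IsStationaryVariance (μ : Measure Ω) (Y : ℝ → Ω → ℝ) (v : ℝ≥0∞) : Prop :=
  Tendsto (fun T : ℝ => (∫⁻ t in Set.Icc 0 T, evariance (Y t) μ) / ENNReal.ofReal T) atTop (𝓝 v)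

end

end DeadlineScheduling

/-! Let J(t) be the work arrived by time t, so that X(t) = J(t) - ∫₀ᵗ P. Centre everything: M = J -
𝔼J, Y = P - 𝔼P, W(t) = ∫₀ᵗ Y, so that M - W is the centred X. The process J is compound Poisson,
hence 𝔼[M(T)²] = aT with a = Λ 𝔼[σ²].

Since W(T)² = 2∫₀ᵀ W Y, each path satisfies M(T)² = (M(T) - W(T))² + 2∫₀ᵀ (M - W)Y + 2∫₀ᵀ (M(T) -
M(s))Y(s) ds. Work arriving after s is independent of the history at s, which determines P(s) almost
surely, so the last term has mean zero. The inequality 2xy ≤ cx² + y²/c then gives, for every c > 0,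
aT ≤ Var X(T) + c∫₀ᵀ Var X + c⁻¹∫₀ᵀ Var P (`lintegral_sq_le_of_uncorrelated`, `energy_inequality`).

Dividing by T, one expects a ≤ cD + c⁻¹ Var(P), and c = a/(2D) yields the bound. The boundary term
Var X(T)/T need not tend to zero, but it cannot stay bounded below by a positive constant, for then
the time averages of Var X would diverge (`ofReal_sq_div_le_of_energy`).

Of the policy, only nonnegativity, local integrability, absence of service before arrival,
measurability and non-anticipation enter. The Poisson input consists of Campbell's formulas for the
first two moments and of `indep_count_history`, all derived from the counts of disjoint sets. -/

namespace DeadlineScheduling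

/-! ### First and second moments of the Poisson law. -/

section PoissonMoments

lemma hasSum_poisson_mul_natCast (r : ℝ≥0) :
    HasSum (fun n : ℕ => Real.exp (-r) * r ^ n / n.factorial * n) r := by
  rw [← hasSum_nat_add_iff' 1]
  have h := (hasSum_one_poissonMeasure r).mul_left (r : ℝ)
  rw [Finset.sum_range_one, Nat.cast_zero, mul_zero, sub_zero, ← mul_one (r : ℝ)]
  refine (congrArg (fun g : ℕ → ℝ => HasSum g _) (funext fun n => ?_)).mpr h
  rw [Nat.factorial_succ]
  push_cast
  field_simp
  ring

/-- Cancelling one factor n against n! and shifting the index leaves r times the series with n + 1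
in place of n², that is, the first moment plus the total mass. -/
lemma hasSum_poisson_mul_natCast_sq (r : ℝ≥0) :
    HasSum (fun n : ℕ => Real.exp (-r) * r ^ n / n.factorial * (n : ℝ) ^ 2) (r + r ^ 2) := by
  rw [← hasSum_nat_add_iff' 1]
  have h := ((hasSum_poisson_mul_natCast r).add (hasSum_one_poissonMeasure r)).mul_left (r : ℝ)
  have e : (r : ℝ) + r ^ 2 = r * (r + 1) := by ring
  rw [Finset.sum_range_one, Nat.cast_zero, zero_pow two_ne_zero, mul_zero, sub_zero, e]
  refine (congrArg (fun g : ℕ → ℝ => HasSum g _) (funext fun n => ?_)).mpr h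
  rw [Nat.factorial_succ]
  push_cast
  field_simp
  ring

lemma lintegral_poissonMeasure (r : ℝ≥0) {g : ℕ → ℝ} (hg : ∀ n, 0 ≤ g n) {s : ℝ}
    (h : HasSum (fun n : ℕ => Real.exp (-r) * r ^ n / n.factorial * g n) s) :
    ∫⁻ n, ENNReal.ofReal (g n) ∂(poissonMeasure r) = ENNReal.ofReal s := by
  rw [poissonMeasure, lintegral_sum_measure, ← h.tsum_eq,
    ENNReal.ofReal_tsum_of_nonneg (fun n => by have := hg n; positivity) h.summable]
  refine tsum_congr fun n => ?_
  rw [lintegral_smul_measure, lintegral_dirac, smul_eq_mul, ENNReal.ofReal_mul (by positivity)]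

lemma lintegral_natCast_poissonMeasure (r : ℝ≥0) :
    ∫⁻ n, (n : ℝ≥0∞) ∂(poissonMeasure r) = r := by
  simpa using lintegral_poissonMeasure r (fun n => n.cast_nonneg) (hasSum_poisson_mul_natCast r)

lemma lintegral_natCast_sq_poissonMeasure (r : ℝ≥0) :
    ∫⁻ n, (n : ℝ≥0∞) ^ 2 ∂(poissonMeasure r) = r + r ^ 2 := by
  have := lintegral_poissonMeasure r (fun n => sq_nonneg (n : ℝ)) (hasSum_poisson_mul_natCast_sq r)
  rw [ENNReal.ofReal_add (by positivity) (by positivity)] at this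
  simpa [ENNReal.ofReal_pow] using this

end PoissonMoments

/-! ### Integrals against the job process, weighted by a random density. -/

section JobProcess

variable {Ω : Type*} {job : ℕ → Ω → ℝ × ℝ × ℝ}

lemma jobProcess_apply (ω : Ω) {B : Set (ℝ × ℝ × ℝ)} (hB : MeasurableSet B) :
    jobProcess job ω B = ∑' k, B.indicator 1 (job k ω) := by
  rw [jobProcess, Measure.sum_apply _ hB]
  exact tsum_congr fun k => Measure.dirac_apply' _ hB

lemma lintegral_jobProcess (ω : Ω) (g : ℝ × ℝ × ℝ → ℝ≥0∞) :
    ∫⁻ p, g p ∂(jobProcess job ω) = ∑' k, g (job k ω) := by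
  simp [jobProcess, lintegral_sum_measure, lintegral_dirac]

variable [MeasurableSpace Ω]

lemma measurable_lintegral_jobProcess (hjob : ∀ k, Measurable (job k))
    {g : ℝ × ℝ × ℝ → ℝ≥0∞} (hg : Measurable g) :
    Measurable fun ω => ∫⁻ p, g p ∂(jobProcess job ω) := by
  simp_rw [lintegral_jobProcess]
  exact Measurable.tsum fun k => hg.comp (hjob k)

lemma measurable_jobProcess_apply (hjob : ∀ k, Measurable (job k))
    {B : Set (ℝ × ℝ × ℝ)} (hB : MeasurableSet B) :
    Measurable fun ω => jobProcess job ω B := by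
  simpa [lintegral_indicator_one hB] using
    measurable_lintegral_jobProcess hjob (measurable_one.indicator hB)

/-- The mean measure of the job process under the density `Z`. -/
noncomputable def weightedMean (μ : Measure Ω) (job : ℕ → Ω → ℝ × ℝ × ℝ) (Z : Ω → ℝ≥0∞) :
    Measure (ℝ × ℝ × ℝ) :=
  Measure.sum fun k => (μ.withDensity Z).map (job k)

variable {μ : Measure Ω}

/-- By Tonelli, g ↦ 𝔼[Z ∫ g dN] is integration against a measure. Identities for it therefore need
checking only on sets, with no approximation by simple functions. -/
lemma lintegral_weightedMean (hjob : ∀ k, Measurable (job k)) {Z : Ω → ℝ≥0∞} (hZ : Measurable Z)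
    {g : ℝ × ℝ × ℝ → ℝ≥0∞} (hg : Measurable g) :
    ∫⁻ p, g p ∂(weightedMean μ job Z) = ∫⁻ ω, Z ω * ∫⁻ p, g p ∂(jobProcess job ω) ∂μ := by
  simp_rw [weightedMean, lintegral_sum_measure, lintegral_jobProcess, ← ENNReal.tsum_mul_left]
  rw [lintegral_tsum (f := fun k ω => Z ω * g (job k ω))
    fun k => (hZ.mul (hg.comp (hjob k))).aemeasurable]
  refine tsum_congr fun k => ?_
  rw [lintegral_map hg (hjob k)]
  exact lintegral_withDensity_eq_lintegral_mul _ hZ (hg.comp (hjob k))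

lemma weightedMean_apply (hjob : ∀ k, Measurable (job k)) {Z : Ω → ℝ≥0∞} (hZ : Measurable Z)
    {B : Set (ℝ × ℝ × ℝ)} (hB : MeasurableSet B) :
    weightedMean μ job Z B = ∫⁻ ω, Z ω * jobProcess job ω B ∂μ := by
  simpa [lintegral_indicator_one hB] using
    lintegral_weightedMean (μ := μ) hjob hZ (measurable_one.indicator hB)

/-- To compute `𝔼[Z ∫ g dN]` for all `g` supported in `S`, it suffices to compute
`𝔼[Z N(B)]` for all measurable `B ⊆ S`. -/
lemma lintegral_mul_poissonIntegral (hjob : ∀ k, Measurable (job k)) {Z : Ω → ℝ≥0∞}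
    (hZ : Measurable Z) {S : Set (ℝ × ℝ × ℝ)} (hS : MeasurableSet S)
    (κ : Measure (ℝ × ℝ × ℝ))
    (h : ∀ B, MeasurableSet B → B ⊆ S → ∫⁻ ω, Z ω * jobProcess job ω B ∂μ = κ B)
    {g : ℝ × ℝ × ℝ → ℝ≥0∞} (hg : Measurable g) (hgS : ∀ p, p ∉ S → g p = 0) :
    ∫⁻ ω, Z ω * ∫⁻ p, g p ∂(jobProcess job ω) ∂μ = ∫⁻ p, g p ∂κ := by
  have hres : (weightedMean μ job Z).restrict S = κ.restrict S := by
    ext B hB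
    rw [Measure.restrict_apply hB, Measure.restrict_apply hB,
      weightedMean_apply hjob hZ (hB.inter hS), h _ (hB.inter hS) Set.inter_subset_right]
  have hind : S.indicator g = g := by
    rw [Set.indicator_eq_self]
    intro p hp
    by_contra hpS
    exact hp (hgS p hpS)
  rw [← lintegral_weightedMean hjob hZ hg, ← hind, lintegral_indicator hS, hres,
    lintegral_indicator hS]

end JobProcess

/-! ### Campbell's formulas and independence of the future from the history. -/

namespace IsPoissonArrivals

variable {Ω : Type*} [MeasurableSpace Ω] {μ : Measure Ω} {Λ : ℝ≥0} {f : Measure (ℝ × ℝ)}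
  {job : ℕ → Ω → ℝ × ℝ × ℝ}

lemma lintegral_count_comp (h : IsPoissonArrivals μ Λ f job) {B : Set (ℝ × ℝ × ℝ)}
    (hB : MeasurableSet B) (hfin : arrivalIntensity Λ f B ≠ ∞) {g : ℝ≥0∞ → ℝ≥0∞}
    (hg : Measurable g) :
    ∫⁻ ω, g (jobProcess job ω B) ∂μ =
      ∫⁻ n, g (n : ℝ≥0∞) ∂(poissonMeasure (arrivalIntensity Λ f B).toNNReal) := by
  have hl := h.hasLaw_count B hB hfin
  rw [← lintegral_map' hg.aemeasurable hl.aemeasurable, hl.map_eq,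
    lintegral_map hg Measurable.of_discrete]

lemma lintegral_count (h : IsPoissonArrivals μ Λ f job) {B : Set (ℝ × ℝ × ℝ)}
    (hB : MeasurableSet B) (hfin : arrivalIntensity Λ f B ≠ ∞) :
    ∫⁻ ω, jobProcess job ω B ∂μ = arrivalIntensity Λ f B := by
  rw [h.lintegral_count_comp hB hfin (g := fun x => x) measurable_id,
    lintegral_natCast_poissonMeasure, ENNReal.coe_toNNReal hfin]

lemma lintegral_count_sq (h : IsPoissonArrivals μ Λ f job) {B : Set (ℝ × ℝ × ℝ)}
    (hB : MeasurableSet B) (hfin : arrivalIntensity Λ f B ≠ ∞) :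
    ∫⁻ ω, jobProcess job ω B ^ 2 ∂μ = arrivalIntensity Λ f B + arrivalIntensity Λ f B ^ 2 := by
  rw [h.lintegral_count_comp hB hfin (g := fun x => x ^ 2) (by fun_prop),
    lintegral_natCast_sq_poissonMeasure, ENNReal.coe_toNNReal hfin]

lemma iIndepFun_count (h : IsPoissonArrivals μ Λ f job) {ι : Type*} [Fintype ι]
    (B : ι → Set (ℝ × ℝ × ℝ)) (hB : ∀ i, MeasurableSet (B i))
    (hd : Pairwise (fun i j => Disjoint (B i) (B j))) :
    iIndepFun (fun i ω => jobProcess job ω (B i)) μ := by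
  have e := Fintype.equivFin ι
  have := h.indep_count (Fintype.card ι) (B ∘ e.symm) (fun i => hB _)
    (fun i j hij => hd (e.symm.injective.ne hij))
  have := this.precomp e.injective
  simpa [Function.comp_def] using this

lemma indepFun_count (h : IsPoissonArrivals μ Λ f job) {B C : Set (ℝ × ℝ × ℝ)}
    (hB : MeasurableSet B) (hC : MeasurableSet C) (hd : Disjoint B C) :
    IndepFun (fun ω => jobProcess job ω B) (fun ω => jobProcess job ω C) μ := by
  have := h.iIndepFun_count (ι := Bool) (fun b => if b then B else C)
    (by rintro (_ | _) <;> simpa) (by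
      rintro (_ | _) (_ | _) hne <;> simp_all [disjoint_comm])
  simpa using this.indepFun (i := true) (j := false) (by simp)

/-- Cut B and C into B ∩ C, B \ C and C \ B. Counts of different pieces are independent, and only
the square of the count of B ∩ C contributes the extra term. -/
lemma lintegral_count_mul_count (h : IsPoissonArrivals μ Λ f job) {B C : Set (ℝ × ℝ × ℝ)}
    (hB : MeasurableSet B) (hC : MeasurableSet C) (hfB : arrivalIntensity Λ f B ≠ ∞)
    (hfC : arrivalIntensity Λ f C ≠ ∞) :
    ∫⁻ ω, jobProcess job ω B * jobProcess job ω C ∂μ =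
      arrivalIntensity Λ f (B ∩ C) + arrivalIntensity Λ f B * arrivalIntensity Λ f C := by
  set l := arrivalIntensity Λ f
  have m := fun {A : Set (ℝ × ℝ × ℝ)} (hA : MeasurableSet A) =>
    measurable_jobProcess_apply h.measurable_job hA
  have fin : ∀ {A A' : Set (ℝ × ℝ × ℝ)}, l A ≠ ∞ → A' ⊆ A → l A' ≠ ∞ :=
    fun hA hs => measure_ne_top_of_subset hs hA
  have indep : ∀ {A A' : Set (ℝ × ℝ × ℝ)}, MeasurableSet A → MeasurableSet A' → l A ≠ ∞ →
      l A' ≠ ∞ → Disjoint A A' →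
      ∫⁻ ω, jobProcess job ω A * jobProcess job ω A' ∂μ = l A * l A' := by
    intro A A' hA hA' fA fA' hd
    rw [← h.lintegral_count hA fA, ← h.lintegral_count hA' fA']
    exact lintegral_mul_eq_lintegral_mul_lintegral_of_indepFun (m hA) (m hA')
      (h.indepFun_count hA hA' hd)
  have dB : ∀ ν : Measure (ℝ × ℝ × ℝ), ν B = ν (B ∩ C) + ν (B \ C) :=
    fun ν => (measure_inter_add_sdiff B hC).symm
  have dC : ∀ ν : Measure (ℝ × ℝ × ℝ), ν C = ν (B ∩ C) + ν (C \ B) := fun ν => by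
    rw [Set.inter_comm, measure_inter_add_sdiff C hB]
  have hI := hB.inter hC
  have hBC := hB.diff hC
  have hCB := hC.diff hB
  have fI := fin hfB (Set.inter_subset_left (t := C))
  have fBC := fin hfB (Set.sdiff_subset (t := C))
  have fCB := fin hfC (Set.sdiff_subset (t := B))
  have e : ∀ ω, jobProcess job ω B * jobProcess job ω C =
      jobProcess job ω (B ∩ C) ^ 2 + jobProcess job ω (B ∩ C) * jobProcess job ω (C \ B)
      + jobProcess job ω (B \ C) * jobProcess job ω (B ∩ C)
      + jobProcess job ω (B \ C) * jobProcess job ω (C \ B) := by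
    intro ω
    rw [dB, dC]
    ring
  simp_rw [e]
  rw [lintegral_add_right _ ((m hBC).fun_mul (m hCB)),
    lintegral_add_right _ ((m hBC).fun_mul (m hI)),
    lintegral_add_right _ ((m hI).fun_mul (m hCB)), h.lintegral_count_sq hI fI,
    indep hI hCB fI fCB (by rw [Set.disjoint_left]; grind),
    indep hBC hI fBC fI (by rw [Set.disjoint_left]; grind),
    indep hBC hCB fBC fCB (by rw [Set.disjoint_left]; grind), dB l, dC l]
  ring

/-- Campbell's formula. -/
lemma lintegral_poissonIntegral (h : IsPoissonArrivals μ Λ f job) {S : Set (ℝ × ℝ × ℝ)}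
    (hS : MeasurableSet S) (hfin : arrivalIntensity Λ f S ≠ ∞)
    {g : ℝ × ℝ × ℝ → ℝ≥0∞} (hg : Measurable g) (hgS : ∀ p, p ∉ S → g p = 0) :
    ∫⁻ ω, ∫⁻ p, g p ∂(jobProcess job ω) ∂μ = ∫⁻ p, g p ∂(arrivalIntensity Λ f) := by
  simpa using lintegral_mul_poissonIntegral h.measurable_job (Z := fun _ => 1)
    measurable_const hS (arrivalIntensity Λ f) (fun B hB hBS => by
      simpa using h.lintegral_count hB (measure_ne_top_of_subset hBS hfin)) hg hgS

/-- The second moment formula for Poisson integrals. -/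
lemma lintegral_poissonIntegral_sq (h : IsPoissonArrivals μ Λ f job) {S : Set (ℝ × ℝ × ℝ)}
    (hS : MeasurableSet S) (hfin : arrivalIntensity Λ f S ≠ ∞)
    {g : ℝ × ℝ × ℝ → ℝ≥0∞} (hg : Measurable g) (hgS : ∀ p, p ∉ S → g p = 0) :
    ∫⁻ ω, (∫⁻ p, g p ∂(jobProcess job ω)) ^ 2 ∂μ =
      ∫⁻ p, g p ^ 2 ∂(arrivalIntensity Λ f) + (∫⁻ p, g p ∂(arrivalIntensity Λ f)) ^ 2 := by
  set l := arrivalIntensity Λ f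
  have hG := measurable_lintegral_jobProcess h.measurable_job hg
  -- The square is polarised: one factor ∫ g dN is first paired with the count of B, using the
  -- product formula for counts. The result, as a measure in B, is then integrated against the
  -- second factor g.
  have key : ∀ B, MeasurableSet B → B ⊆ S →
      ∫⁻ ω, (∫⁻ p, g p ∂(jobProcess job ω)) * jobProcess job ω B ∂μ =
        (l.withDensity g + (∫⁻ p, g p ∂l) • l) B := by
    intro B hB hBS
    have hfB : l B ≠ ∞ := measure_ne_top_of_subset hBS hfin
    simp_rw [mul_comm _ (jobProcess job _ B)]
    rw [lintegral_mul_poissonIntegral h.measurable_job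
      (measurable_jobProcess_apply h.measurable_job hB) hS (l.restrict B + l B • l)
      (fun C hC hCS => by
        rw [h.lintegral_count_mul_count hB hC hfB (measure_ne_top_of_subset hCS hfin)]
        simp [Measure.restrict_apply hC, Set.inter_comm, l]) hg hgS]
    rw [lintegral_add_measure, lintegral_smul_measure]
    simp [withDensity_apply _ hB, mul_comm]
  simp_rw [sq]
  rw [lintegral_mul_poissonIntegral h.measurable_job hG hS _ key hg hgS,
    lintegral_add_measure, lintegral_smul_measure, lintegral_withDensity_eq_lintegral_mul _ hg hg]
  rfl

/-- The number of future jobs in a set is independent of the history. -/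
lemma indep_count_history [IsProbabilityMeasure μ] (h : IsPoissonArrivals μ Λ f job) (s : ℝ)
    {C : Set (ℝ × ℝ × ℝ)} (hC : MeasurableSet C) (hCs : ∀ p ∈ C, s < p.1) :
    Indep (history job s) (MeasurableSpace.comap (fun ω => jobProcess job ω C) inferInstance)
      μ := by
  classical
  have hs : MeasurableSet {p : ℝ × ℝ × ℝ | p.1 ≤ s} := measurableSet_le measurable_fst
    measurable_const
  have m := fun {A : Set (ℝ × ℝ × ℝ)} (hA : MeasurableSet A) =>
    measurable_jobProcess_apply h.measurable_job hA
  let I := {B : Set (ℝ × ℝ × ℝ) // MeasurableSet B}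
  -- The history is the directed supremum of the σ-algebras generated by finitely many counts, so
  -- independence is needed only for these.
  let F : Finset I → MeasurableSpace Ω := fun t => ⨆ B : t,
    MeasurableSpace.comap (fun ω => jobProcess job ω (B.1.1 ∩ {p | p.1 ≤ s})) inferInstance
  have hF : history job s ≤ ⨆ t, F t := by
    refine iSup₂_le fun B hB => ?_
    refine le_trans ?_ (le_iSup F {⟨B, hB⟩})
    exact le_iSup (fun B' : ({⟨B, hB⟩} : Finset I) => MeasurableSpace.comap
      (fun ω => jobProcess job ω (B'.1.1 ∩ {p | p.1 ≤ s})) inferInstance)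
      ⟨⟨B, hB⟩, Finset.mem_singleton_self _⟩
  refine indep_of_indep_of_le_left (indep_iSup_of_directed_le ?_ ?_ ?_ ?_) hF
  · intro t
    -- Independence is known only for disjoint sets, whereas the sets in `t` may overlap. The fibres
    -- of the membership pattern `φ` are the atoms they generate; cut at time `s`, they are disjoint
    -- from each other and from `C`.
    let φ : ℝ × ℝ × ℝ → (t → Prop) := fun p B => p ∈ B.1.1
    have hφ : ∀ v, MeasurableSet (φ ⁻¹' {v}) := by
      intro v
      have : φ ⁻¹' {v} = ⋂ B : t, {p | p ∈ B.1.1 ↔ v B} := by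
        ext p; simp [φ, funext_iff]
      rw [this]
      refine MeasurableSet.iInter fun B => ?_
      by_cases hv : v B
      · simp only [hv, iff_true]
        exact B.1.2
      · simp only [hv, iff_false]
        exact B.1.2.compl
    let A : Option (t → Prop) → Set (ℝ × ℝ × ℝ) := fun o =>
      o.elim C (fun v => φ ⁻¹' {v} ∩ {p | p.1 ≤ s})
    have hA : ∀ o, MeasurableSet (A o) := by
      rintro (_ | v)
      · exact hC
      · exact (hφ v).inter hs
    have hAd : Pairwise (fun i j => Disjoint (A i) (A j)) := by
      rintro (_ | v) (_ | w) hne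
      · exact absurd rfl hne
      · refine Set.disjoint_left.2 fun p hp hp' => ?_
        exact absurd (hCs p hp) (not_lt.2 hp'.2)
      · refine Set.disjoint_left.2 fun p hp hp' => ?_
        exact absurd (hCs p hp') (not_lt.2 hp.2)
      · refine Set.disjoint_left.2 fun p hp hp' => ?_
        have h1 : φ p = v := hp.1
        have h2 : φ p = w := hp'.1
        exact hne (by rw [← h1, ← h2])
    have hi := (h.iIndepFun_count A hA hAd).indepFun_finset
      (Finset.univ.erase none) {none} (by simp) (fun i => m (hA i))
    have hi2 : IndepFun (fun ω (i : (Finset.univ.erase (none : Option (t → Prop)))) =>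
        jobProcess job ω (A i)) (fun ω => jobProcess job ω C) μ :=
      hi.comp measurable_id
        (measurable_pi_apply (⟨none, Finset.mem_singleton_self _⟩ : ({none} : Finset _)))
    refine indep_of_indep_of_le_left hi2 ?_
    refine iSup_le fun B => ?_
    rw [← measurable_iff_comap_le]
    -- Each original count is the sum over the atoms contained in its set, hence a function of the
    -- atom counts.
    have hsum : ∀ ω, jobProcess job ω (B.1.1 ∩ {p | p.1 ≤ s}) =
        ∑ v : {v : t → Prop // v B}, jobProcess job ω (A (some v.1)) := by
      intro ω
      rw [← tsum_fintype (L := .unconditional _), ← measure_iUnion _ (fun v => hA _)]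
      · congr 1
        ext p
        simp [A, φ]
      · intro v w hne
        exact hAd (by simpa [Subtype.ext_iff] using hne)
    simp_rw [hsum]
    refine Finset.measurable_sum _ fun v _ => ?_
    exact (measurable_pi_apply (⟨some v.1, by simp⟩ :
      (Finset.univ.erase (none : Option (t → Prop))))).comp (comap_measurable
        (fun ω (i : (Finset.univ.erase (none : Option (t → Prop)))) => jobProcess job ω (A i)))
  · intro t
    refine iSup_le fun B => ?_
    rw [← measurable_iff_comap_le]
    exact m (B.1.2.inter hs)
  · rw [← measurable_iff_comap_le]
    exact m hC
  · intro t t'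
    refine ⟨t ∪ t', iSup_le fun B => ?_, iSup_le fun B => ?_⟩
    · exact le_iSup (fun B' : ((t ∪ t' : Finset I)) => MeasurableSpace.comap
        (fun ω => jobProcess job ω (B'.1.1 ∩ {p | p.1 ≤ s})) inferInstance)
        ⟨B.1, Finset.mem_union_left _ B.2⟩
    · exact le_iSup (fun B' : ((t ∪ t' : Finset I)) => MeasurableSpace.comap
        (fun ω => jobProcess job ω (B'.1.1 ∩ {p | p.1 ≤ s})) inferInstance)
        ⟨B.1, Finset.mem_union_right _ B.2⟩

lemma history_le (h : IsPoissonArrivals μ Λ f job) (s : ℝ) : history job s ≤ ‹_› := by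
  refine iSup₂_le fun B hB => ?_
  rw [← measurable_iff_comap_le]
  exact measurable_jobProcess_apply h.measurable_job
    (hB.inter (measurableSet_le measurable_fst measurable_const))

/-- Integrals over future jobs are uncorrelated with what the history determines. -/
lemma lintegral_history_mul [IsProbabilityMeasure μ] (h : IsPoissonArrivals μ Λ f job) (s : ℝ)
    {S : Set (ℝ × ℝ × ℝ)} (hS : MeasurableSet S) (hfin : arrivalIntensity Λ f S ≠ ∞)
    (hSs : ∀ p ∈ S, s < p.1) {Z : Ω → ℝ≥0∞} (hZ : Measurable[history job s] Z)
    {g : ℝ × ℝ × ℝ → ℝ≥0∞} (hg : Measurable g) (hgS : ∀ p, p ∉ S → g p = 0) :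
    ∫⁻ ω, Z ω * ∫⁻ p, g p ∂(jobProcess job ω) ∂μ =
      (∫⁻ ω, Z ω ∂μ) * ∫⁻ p, g p ∂(arrivalIntensity Λ f) := by
  rw [lintegral_mul_poissonIntegral h.measurable_job (hZ.mono (h.history_le s) le_rfl) hS
    ((∫⁻ ω, Z ω ∂μ) • arrivalIntensity Λ f) _ hg hgS, lintegral_smul_measure, smul_eq_mul]
  intro B hB hBS
  rw [lintegral_mul_eq_lintegral_mul_lintegral_of_independent_measurableSpace (h.history_le s)
    ((measurable_jobProcess_apply h.measurable_job hB).comap_le)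
    (h.indep_count_history s hB fun p hp => hSs p (hBS hp)) hZ (comap_measurable _),
    h.lintegral_count hB (measure_ne_top_of_subset hBS hfin)]
  rfl

end IsPoissonArrivals

/-! ### The energy estimate for a process with increments uncorrelated with the control. -/

section EnergyEstimate

/-- The primitive is absolutely continuous with derivative y almost everywhere, so this is
integration by parts for its square; y need not be continuous. -/
lemma two_mul_integral_primitive_mul {y : ℝ → ℝ} {a b : ℝ} (hy : IntervalIntegrable y volume a b) :
    2 * ∫ s in a..b, (∫ u in a..s, y u) * y s = (∫ s in a..b, y s) ^ 2 := by
  have hac := hy.absolutelyContinuousOnInterval_intervalIntegral (c := a) (by simp)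
  have h := hac.integral_deriv_mul_eq_sub hac
  rw [intervalIntegral.integral_same, mul_zero, sub_zero, ← sq] at h
  rw [← h, ← intervalIntegral.integral_const_mul]
  refine intervalIntegral.integral_congr_ae ?_
  filter_upwards [hy.ae_hasDerivAt_integral] with s hs hsm
  rw [(hs (Set.uIoc_subset_uIcc hsm) a (by simp)).deriv]
  ring

variable {Ω : Type*} [MeasurableSpace Ω] {μ : Measure Ω}

lemma memLp_two_of_lintegral_ofReal_sq {α : Type*} [MeasurableSpace α] {ρ : Measure α} {g : α → ℝ}
    (hg : AEStronglyMeasurable g ρ) (h : ∫⁻ x, ENNReal.ofReal (g x ^ 2) ∂ρ ≠ ∞) :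
    MemLp g 2 ρ := by
  rw [memLp_two_iff_integrable_sq hg]
  refine ⟨hg.pow 2, ?_⟩
  rw [hasFiniteIntegral_iff_ofReal (ae_of_all _ fun x => sq_nonneg _)]
  exact h.lt_top

lemma lintegral_ofReal_sq {α : Type*} [MeasurableSpace α] {ρ : Measure α} {g : α → ℝ}
    (hg : MemLp g 2 ρ) :
    ∫⁻ x, ENNReal.ofReal (g x ^ 2) ∂ρ = ENNReal.ofReal (∫ x, g x ^ 2 ∂ρ) :=
  (ofReal_integral_eq_lintegral_ofReal hg.integrable_sq (ae_of_all _ fun _ => sq_nonneg _)).symm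

lemma measurable_uncurry_primitive {Y : ℝ → Ω → ℝ}
    (hY : Measurable (Function.uncurry Y)) :
    Measurable fun z : ℝ × Ω => ∫ u in (0 : ℝ)..z.1, Y u z.2 := by
  have h1 : Measurable fun z : ℝ × Ω => ∫ u in Set.Ioc 0 z.1, Y u z.2 := by
    have : ∀ z : ℝ × Ω, ∫ u in Set.Ioc 0 z.1, Y u z.2 =
        ∫ u, {q : (ℝ × Ω) × ℝ | 0 < q.2 ∧ q.2 ≤ q.1.1}.indicator (fun q => Y q.2 q.1.2) (z, u) := by
      intro z
      rw [← integral_indicator measurableSet_Ioc]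
      rfl
    simp_rw [this]
    refine (StronglyMeasurable.integral_prod_right (f := fun (z : ℝ × Ω) (u : ℝ) =>
      {q : (ℝ × Ω) × ℝ | 0 < q.2 ∧ q.2 ≤ q.1.1}.indicator (fun q => Y q.2 q.1.2) (z, u))
      ?_).measurable
    refine Measurable.stronglyMeasurable (Measurable.indicator ?_ ?_)
    · exact hY.comp (by fun_prop : Measurable fun q : (ℝ × Ω) × ℝ => (q.2, q.1.2))
    · exact (measurableSet_lt measurable_const measurable_snd).inter
        (measurableSet_le measurable_snd (by fun_prop))
  have h2 : Measurable fun z : ℝ × Ω => ∫ u in Set.Ioc z.1 0, Y u z.2 := by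
    have : ∀ z : ℝ × Ω, ∫ u in Set.Ioc z.1 0, Y u z.2 =
        ∫ u, {q : (ℝ × Ω) × ℝ | q.1.1 < q.2 ∧ q.2 ≤ 0}.indicator (fun q => Y q.2 q.1.2) (z, u) := by
      intro z
      rw [← integral_indicator measurableSet_Ioc]
      rfl
    simp_rw [this]
    refine (StronglyMeasurable.integral_prod_right (f := fun (z : ℝ × Ω) (u : ℝ) =>
      {q : (ℝ × Ω) × ℝ | q.1.1 < q.2 ∧ q.2 ≤ 0}.indicator (fun q => Y q.2 q.1.2) (z, u))
      ?_).measurable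
    refine Measurable.stronglyMeasurable (Measurable.indicator ?_ ?_)
    · exact hY.comp (by fun_prop : Measurable fun q : (ℝ × Ω) × ℝ => (q.2, q.1.2))
    · exact (measurableSet_lt (by fun_prop) measurable_snd).inter
        (measurableSet_le measurable_snd measurable_const)
  exact h1.sub h2

/-- If the increments of `M` are uncorrelated with `Y`, the variance of `M T` is controlled by
those of `X = M - ∫ Y` and `Y`. -/
lemma lintegral_sq_le_of_uncorrelated [IsProbabilityMeasure μ] {T c : ℝ} (hT : 0 ≤ T) (hc : 0 < c)
    {M Y : ℝ → Ω → ℝ} {B : Ω → ℝ} (hM : Measurable (Function.uncurry M)) (hB : MemLp B 2 μ)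
    (hMB : ∀ᵐ ω ∂μ, ∀ s ∈ Set.Icc 0 T, |M s ω| ≤ B ω) (hYm : Measurable (Function.uncurry Y))
    (hY : ∫⁻ s in Set.Icc 0 T, ∫⁻ ω, ENNReal.ofReal (Y s ω ^ 2) ∂μ ≠ ∞)
    (orth : ∀ᵐ s ∂volume.restrict (Set.Icc 0 T), ∫ ω, (M T ω - M s ω) * Y s ω ∂μ = 0) :
    ∫⁻ ω, ENNReal.ofReal (M T ω ^ 2) ∂μ ≤
      ∫⁻ ω, ENNReal.ofReal ((M T ω - ∫ u in (0 : ℝ)..T, Y u ω) ^ 2) ∂μ +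
      ENNReal.ofReal c * (∫⁻ s in Set.Icc 0 T, ∫⁻ ω,
        ENNReal.ofReal ((M s ω - ∫ u in (0 : ℝ)..s, Y u ω) ^ 2) ∂μ) +
      ENNReal.ofReal c⁻¹ * ∫⁻ s in Set.Icc 0 T, ∫⁻ ω, ENNReal.ofReal (Y s ω ^ 2) ∂μ := by
  set ν := (volume : Measure ℝ).restrict (Set.Icc 0 T) with hν
  set W : ℝ → Ω → ℝ := fun s ω => ∫ u in (0 : ℝ)..s, Y u ω with hW
  have hWm : Measurable (Function.uncurry W) := measurable_uncurry_primitive hYm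
  set y : ℝ × Ω → ℝ := fun z => Y z.1 z.2 with hy
  set m : ℝ × Ω → ℝ := fun z => M z.1 z.2 with hm
  set w : ℝ × Ω → ℝ := fun z => W z.1 z.2 with hw
  set mT : ℝ × Ω → ℝ := fun z => M T z.2 with hmT
  have hyL : MemLp y 2 (ν.prod μ) := by
    refine memLp_two_of_lintegral_ofReal_sq hYm.aestronglyMeasurable ?_
    exact (lintegral_prod _ (hYm.pow_const 2).ennreal_ofReal.aemeasurable).trans_ne hY
  have hMTm : Measurable (M T) := hM.comp (by fun_prop : Measurable fun ω => (T, ω))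
  have hMT : MemLp (M T) 2 μ := hB.mono' hMTm.aestronglyMeasurable (by
    filter_upwards [hMB] with ω hω using hω T ⟨hT, le_rfl⟩)
  have hmTL : MemLp mT 2 (ν.prod μ) := hMT.comp_snd ν
  have hmem : ∀ᵐ z ∂(ν.prod μ), z.1 ∈ Set.Icc 0 T :=
    Measure.quasiMeasurePreserving_fst.ae (ae_restrict_mem measurableSet_Icc)
  have hmL : MemLp m 2 (ν.prod μ) := by
    refine (hB.comp_snd ν).mono' hM.aestronglyMeasurable ?_
    filter_upwards [hmem, Measure.quasiMeasurePreserving_snd.ae hMB] with z hz h using h _ hz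
  -- the primitive is bounded by the integral of `|Y|`
  have hyi : Integrable y (ν.prod μ) := hyL.integrable one_le_two
  have hslice : ∀ᵐ ω ∂μ, Integrable (fun s => Y s ω) ν := hyi.prod_left_ae
  have hslice2 : ∀ᵐ ω ∂μ, Integrable (fun s => Y s ω ^ 2) ν := hyL.integrable_sq.prod_left_ae
  set V : Ω → ℝ := fun ω => ∫ s, |Y s ω| ∂ν with hV
  -- `V` dominates the primitive `W` on all of [0, T]. Its square integrability is the
  -- Cauchy–Schwarz bound V² ≤ T∫Y², obtained below by integrating (T|Y| - V)² ≥ 0.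
  have hVm : StronglyMeasurable V :=
    StronglyMeasurable.integral_prod_left (f := fun s ω => |Y s ω|) hYm.abs.stronglyMeasurable
  have hVL : MemLp V 2 μ := by
    rw [memLp_two_iff_integrable_sq hVm.aestronglyMeasurable]
    have hI : Integrable (fun ω => T * ∫ s, Y s ω ^ 2 ∂ν) μ :=
      hyL.integrable_sq.integral_prod_right.const_mul T
    refine hI.mono' (hVm.aestronglyMeasurable.pow 2) ?_
    filter_upwards [hslice, hslice2] with ω h1 h2
    rw [Real.norm_of_nonneg (sq_nonneg _)]
    have hTν : ν.real Set.univ = T := by simp [hν, measureReal_def, hT]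
    have h3 : 0 ≤ ∫ s, (T * |Y s ω| - V ω) ^ 2 ∂ν := integral_nonneg fun s => sq_nonneg _
    have h4 : ∫ s, (T * |Y s ω| - V ω) ^ 2 ∂ν =
        T ^ 2 * (∫ s, Y s ω ^ 2 ∂ν) - T * V ω ^ 2 := by
      have e : ∀ s, (T * |Y s ω| - V ω) ^ 2 =
          T ^ 2 * Y s ω ^ 2 - 2 * T * V ω * |Y s ω| + V ω ^ 2 := by
        intro s
        rw [← sq_abs (Y s ω)]
        ring
      simp_rw [e]
      rw [integral_add (by fun_prop) (by fun_prop), integral_sub (by fun_prop) (by fun_prop),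
        integral_const_mul, integral_const_mul, integral_const, hTν]
      simp only [smul_eq_mul]
      rw [show ∫ s, |Y s ω| ∂ν = V ω from rfl]
      ring
    rcases hT.eq_or_lt with rfl | hT'
    · have : ν = 0 := by simp [hν]
      simp [hV, this]
    · rw [h4] at h3
      have : 0 ≤ T * (T * (∫ s, Y s ω ^ 2 ∂ν) - V ω ^ 2) := by linarith
      have := nonneg_of_mul_nonneg_right this hT'
      linarith
  have hii : ∀ ω, Integrable (fun s => Y s ω) ν →
      IntervalIntegrable (fun s => Y s ω) volume 0 T := by
    intro ω h
    rw [intervalIntegrable_iff_integrableOn_Icc_of_le hT]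
    exact h
  have hIcc : ∀ g : ℝ → ℝ, ∫ s in (0 : ℝ)..T, g s = ∫ s, g s ∂ν := by
    intro g
    rw [intervalIntegral.integral_of_le hT, hν, integral_Icc_eq_integral_Ioc]
  have hWV : ∀ᵐ ω ∂μ, ∀ s ∈ Set.Icc 0 T, |W s ω| ≤ V ω := by
    filter_upwards [hslice] with ω h s hs
    calc |W s ω| ≤ ∫ u in (0 : ℝ)..s, |Y u ω| := by
          simpa using intervalIntegral.abs_integral_le_integral_abs hs.1
      _ = ∫ u in Set.Ioc 0 s, |Y u ω| := intervalIntegral.integral_of_le hs.1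
      _ ≤ V ω := setIntegral_mono_set h.abs (ae_of_all _ fun _ => abs_nonneg _)
          (Set.Ioc_subset_Icc_self.trans (Set.Icc_subset_Icc le_rfl hs.2)).eventuallyLE
  have hwL : MemLp w 2 (ν.prod μ) := by
    refine (hVL.comp_snd ν).mono' hWm.aestronglyMeasurable ?_
    filter_upwards [hmem, Measure.quasiMeasurePreserving_snd.ae hWV] with z hz h using h _ hz
  have hWTm : Measurable (W T) := hWm.comp (by fun_prop : Measurable fun ω => (T, ω))
  have hWT : MemLp (W T) 2 μ := hVL.mono' hWTm.aestronglyMeasurable (by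
    filter_upwards [hWV] with ω hω using hω T ⟨hT, le_rfl⟩)
  have hxy : Integrable (fun z => (m z - w z) * y z) (ν.prod μ) := (hmL.sub hwL).integrable_mul hyL
  have hky : Integrable (fun z => (mT z - m z) * y z) (ν.prod μ) :=
    (hmTL.sub hmL).integrable_mul hyL
  have hwy : Integrable (fun z => w z * y z) (ν.prod μ) := hwL.integrable_mul hyL
  -- This is M(T)² - (M(T) - W(T))² = 2M(T)W(T) - W(T)², with M(T)W(T) = ∫ M(T)Y and W(T)² = 2∫ WY.
  -- No regularity of M in time is needed, since M is never differentiated.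
  have path : ∀ᵐ ω ∂μ, M T ω ^ 2 = (M T ω - W T ω) ^ 2 +
      2 * (∫ s, (M s ω - W s ω) * Y s ω ∂ν) + 2 * ∫ s, (M T ω - M s ω) * Y s ω ∂ν := by
    filter_upwards [hslice, hxy.prod_left_ae, hky.prod_left_ae, hwy.prod_left_ae] with ω h1 h2 h3 h4
    have e1 := two_mul_integral_primitive_mul (hii ω h1)
    rw [hIcc] at e1
    have e2 : ∫ s, (M s ω - W s ω) * Y s ω ∂ν + ∫ s, (M T ω - M s ω) * Y s ω ∂ν =
        M T ω * W T ω - ∫ s, W s ω * Y s ω ∂ν := by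
      rw [← integral_add h2 h3, show W T ω = ∫ s, Y s ω ∂ν from hIcc _, ← integral_const_mul,
        ← integral_sub (h1.const_mul _) h4]
      congr 1
      ext s
      simp only [hm, hw, hmT, hy]
      ring
    have e3 : 2 * ∫ s, W s ω * Y s ω ∂ν = W T ω ^ 2 := e1
    linear_combination (-2) * e2 + e3
  have hort : ∫ z, (mT z - m z) * y z ∂(ν.prod μ) = 0 := by
    rw [integral_prod _ hky]
    exact integral_eq_zero_of_ae orth
  have hid : ∫ ω, M T ω ^ 2 ∂μ = ∫ ω, (M T ω - W T ω) ^ 2 ∂μ +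
      2 * ∫ z, (m z - w z) * y z ∂(ν.prod μ) := by
    rw [integral_congr_ae path, integral_add, integral_add, integral_const_mul, integral_const_mul]
    · have a1 := integral_prod_symm _ hxy
      have a2 := integral_prod_symm _ hky
      rw [hort] at a2
      simp only [hm, hw, hmT, hy] at a1 a2 ⊢
      rw [a1, ← a2]
      ring
    · exact (hMT.sub hWT).integrable_sq
    · exact hxy.integral_prod_right.const_mul 2
    · exact (hMT.sub hWT).integrable_sq.add (hxy.integral_prod_right.const_mul 2)
    · exact hky.integral_prod_right.const_mul 2
  have hamgm : 2 * ∫ z, (m z - w z) * y z ∂(ν.prod μ) ≤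
      c * ∫ z, (m z - w z) ^ 2 ∂(ν.prod μ) + c⁻¹ * ∫ z, y z ^ 2 ∂(ν.prod μ) := by
    have i1 : Integrable (fun z => c * (m z - w z) ^ 2) (ν.prod μ) :=
      (hmL.sub hwL).integrable_sq.const_mul c
    have i2 : Integrable (fun z => c⁻¹ * y z ^ 2) (ν.prod μ) := hyL.integrable_sq.const_mul c⁻¹
    rw [← integral_const_mul, ← integral_const_mul, ← integral_const_mul, ← integral_add i1 i2]
    refine integral_mono (hxy.const_mul 2) (i1.add i2) fun z => ?_
    have : 0 ≤ c⁻¹ * (c * (m z - w z) - y z) ^ 2 := by positivity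
    have e : c⁻¹ * (c * (m z - w z) - y z) ^ 2 =
        c * (m z - w z) ^ 2 - 2 * ((m z - w z) * y z) + c⁻¹ * y z ^ 2 := by
      field_simp
      ring
    linarith
  have p1 : ∫⁻ s, ∫⁻ ω, ENNReal.ofReal (Y s ω ^ 2) ∂μ ∂ν =
      ∫⁻ z, ENNReal.ofReal (y z ^ 2) ∂(ν.prod μ) :=
    (lintegral_prod _ (hYm.pow_const 2).ennreal_ofReal.aemeasurable).symm
  have p2 : ∫⁻ s, ∫⁻ ω, ENNReal.ofReal ((M s ω - ∫ u in (0 : ℝ)..s, Y u ω) ^ 2) ∂μ ∂ν =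
      ∫⁻ z, ENNReal.ofReal ((m z - w z) ^ 2) ∂(ν.prod μ) :=
    (lintegral_prod _ ((hM.sub hWm).pow_const 2).ennreal_ofReal.aemeasurable).symm
  rw [p1, p2,
    lintegral_ofReal_sq hMT, lintegral_ofReal_sq hyL,
    lintegral_ofReal_sq (g := fun ω => M T ω - W T ω) (hMT.sub hWT),
    lintegral_ofReal_sq (g := fun z => m z - w z) (hmL.sub hwL),
    ← ENNReal.ofReal_mul hc.le, ← ENNReal.ofReal_mul (inv_nonneg.2 hc.le),
    ← ENNReal.ofReal_add (integral_nonneg fun _ => sq_nonneg _)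
      (mul_nonneg hc.le (integral_nonneg fun _ => sq_nonneg _)),
    ← ENNReal.ofReal_add (add_nonneg (integral_nonneg fun _ => sq_nonneg _)
      (mul_nonneg hc.le (integral_nonneg fun _ => sq_nonneg _)))
      (mul_nonneg (inv_nonneg.2 hc.le) (integral_nonneg fun _ => sq_nonneg _))]
  refine ENNReal.ofReal_le_ofReal ?_
  rw [hid]
  linarith [hamgm]

end EnergyEstimate

/-- The total work of the jobs that arrived up to time `t`. -/
noncomputable def arrivedWork {Ω : Type*} (job : ℕ → Ω → ℝ × ℝ × ℝ) (t : ℝ) (ω : Ω) : ℝ≥0∞ :=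
  ∑' k, if (job k ω).1 ≤ t then ENNReal.ofReal (job k ω).2.1 else 0

/-- The total service rate, as an extended nonnegative number. -/
noncomputable def totalRate {Ω : Type*} (r : ℕ → ℝ → Ω → ℝ) (t : ℝ) (ω : Ω) : ℝ≥0∞ :=
  ∑' k, ENNReal.ofReal (r k t ω)

/-! ### Path by path: finite sums and the balance of work. -/

section Pathwise

variable {Ω : Type*} {job : ℕ → Ω → ℝ × ℝ × ℝ} {r : ℕ → ℝ → Ω → ℝ} {ω : Ω}

lemma totalRate_eq_sum (hzero : ∀ k t, t < (job k ω).1 → r k t ω = 0) {t : ℝ}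
    (hfin : {k | (job k ω).1 ≤ t}.Finite) {u : ℝ} (hu : u ≤ t) :
    totalRate r u ω = ∑ k ∈ hfin.toFinset, ENNReal.ofReal (r k u ω) := by
  refine tsum_eq_sum fun k hk => ?_
  rw [hzero k u (lt_of_le_of_lt hu (by simpa using hk)), ENNReal.ofReal_zero]

lemma toReal_totalRate_eq_sum (hnn : ∀ k t, 0 ≤ r k t ω)
    (hzero : ∀ k t, t < (job k ω).1 → r k t ω = 0) {t : ℝ}
    (hfin : {k | (job k ω).1 ≤ t}.Finite) {u : ℝ} (hu : u ≤ t) :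
    (totalRate r u ω).toReal = ∑ k ∈ hfin.toFinset, r k u ω := by
  rw [totalRate_eq_sum hzero hfin hu, ENNReal.toReal_sum fun _ _ => ENNReal.ofReal_ne_top]
  exact Finset.sum_congr rfl fun k _ => ENNReal.toReal_ofReal (hnn k u)

lemma totalRate_ne_top (hzero : ∀ k t, t < (job k ω).1 → r k t ω = 0) {t : ℝ}
    (hfin : {k | (job k ω).1 ≤ t}.Finite) : totalRate r t ω ≠ ∞ := by
  rw [totalRate_eq_sum hzero hfin le_rfl]
  exact ENNReal.sum_ne_top.2 fun _ _ => ENNReal.ofReal_ne_top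

lemma serviceCapacity_eq (hnn : ∀ k t, 0 ≤ r k t ω)
    (hzero : ∀ k t, t < (job k ω).1 → r k t ω = 0) {t : ℝ}
    (hfin : {k | (job k ω).1 ≤ t}.Finite) :
    serviceCapacity r t ω = (totalRate r t ω).toReal := by
  rw [toReal_totalRate_eq_sum hnn hzero hfin le_rfl]
  exact tsum_eq_sum fun k hk => hzero k t (by simpa using hk)

lemma arrivedWork_eq_sum {t : ℝ} (hfin : {k | (job k ω).1 ≤ t}.Finite) :
    arrivedWork job t ω = ∑ k ∈ hfin.toFinset, ENNReal.ofReal (job k ω).2.1 := by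
  rw [arrivedWork, tsum_eq_sum (s := hfin.toFinset)]
  · exact Finset.sum_congr rfl fun k hk => if_pos (by simpa using hk)
  · exact fun k hk => if_neg (by simpa using hk)

lemma intervalIntegrable_totalRate (hnn : ∀ k t, 0 ≤ r k t ω)
    (hloc : ∀ k, LocallyIntegrable fun t => r k t ω)
    (hzero : ∀ k t, t < (job k ω).1 → r k t ω = 0) {t : ℝ} (ht : 0 ≤ t)
    (hfin : {k | (job k ω).1 ≤ t}.Finite) :
    IntervalIntegrable (fun u => (totalRate r u ω).toReal) volume 0 t := by
  have h : IntervalIntegrable (fun u => ∑ k ∈ hfin.toFinset, r k u ω) volume 0 t := by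
    have := IntervalIntegrable.sum (μ := volume) (a := 0) (b := t) hfin.toFinset
      (f := fun k u => r k u ω) fun k _ =>
        ((hloc k).integrableOn_isCompact isCompact_uIcc).intervalIntegrable
    simpa [Finset.sum_fn] using this
  refine h.congr ?_
  intro u hu
  rw [Set.uIoc_of_le ht] at hu
  exact (toReal_totalRate_eq_sum hnn hzero hfin hu.2).symm

/-- The balance equation `X(t) = J(t) - ∫₀ᵗ P(s) ds`. -/
lemma totalRemainingDemand_eq (hnn : ∀ k t, 0 ≤ r k t ω)
    (hloc : ∀ k, LocallyIntegrable fun t => r k t ω)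
    (hzero : ∀ k t, t < (job k ω).1 → r k t ω = 0) {t : ℝ} (ht : 0 ≤ t)
    (hfin : {k | (job k ω).1 ≤ t}.Finite) (ha : ∀ k, 0 ≤ (job k ω).1)
    (hs : ∀ k, 0 ≤ (job k ω).2.1) :
    totalRemainingDemand job r t ω =
      (arrivedWork job t ω).toReal - ∫ u in (0 : ℝ)..t, (totalRate r u ω).toReal := by
  have e1 : ∫ u in (0 : ℝ)..t, (totalRate r u ω).toReal =
      ∑ k ∈ hfin.toFinset, ∫ u in (0 : ℝ)..t, r k u ω := by
    rw [← intervalIntegral.integral_finsetSum fun k _ =>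
      ((hloc k).integrableOn_isCompact isCompact_uIcc).intervalIntegrable]
    refine intervalIntegral.integral_congr fun u hu => ?_
    rw [Set.uIcc_of_le ht] at hu
    exact toReal_totalRate_eq_sum hnn hzero hfin hu.2
  rw [e1, arrivedWork_eq_sum hfin, ENNReal.toReal_sum fun _ _ => ENNReal.ofReal_ne_top,
    ← Finset.sum_sub_distrib, totalRemainingDemand, tsum_eq_sum (s := hfin.toFinset)]
  · refine Finset.sum_congr rfl fun k hk => ?_
    have hk' : (job k ω).1 ≤ t := by simpa using hk
    rw [if_pos hk', remainingDemand, ENNReal.toReal_ofReal (hs k),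
      ← intervalIntegral.integral_add_adjacent_intervals (a := 0) (b := (job k ω).1) (c := t)
        ((hloc k).integrableOn_isCompact isCompact_uIcc).intervalIntegrable
        ((hloc k).integrableOn_isCompact isCompact_uIcc).intervalIntegrable]
    have : ∫ u in (0 : ℝ)..(job k ω).1, r k u ω = 0 := by
      rw [intervalIntegral.integral_of_le (ha k), integral_Ioc_eq_integral_Ioo]
      exact setIntegral_eq_zero_of_forall_eq_zero fun u hu => hzero k u hu.2
    rw [this, zero_add]
  · exact fun k hk => if_neg (by simpa using hk)

end Pathwise

/-! ### Integrals and null sets of the intensity measure. -/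

section Intensity

variable {Λ : ℝ≥0} {f : Measure (ℝ × ℝ)}

lemma lintegral_arrivalIntensity_of_le [SFinite f] {φ : ℝ × ℝ → ℝ≥0∞} (hφ : Measurable φ) (t : ℝ) :
    ∫⁻ p, (if p.1 ≤ t then φ p.2 else 0) ∂(arrivalIntensity Λ f) =
      Λ * (ENNReal.ofReal t * ∫⁻ q, φ q ∂f) := by
  have hm : Measurable fun p : ℝ × ℝ × ℝ => if p.1 ≤ t then φ p.2 else 0 :=
    Measurable.ite (measurableSet_le measurable_fst measurable_const)
      (hφ.comp measurable_snd) measurable_const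
  rw [arrivalIntensity, lintegral_smul_measure, lintegral_prod _ hm.aemeasurable]
  have e : ∀ a : ℝ, ∫⁻ q, (if a ≤ t then φ q else 0) ∂f =
      (Set.Iic t).indicator (fun _ => ∫⁻ q, φ q ∂f) a := by
    intro a
    by_cases h : a ≤ t <;> simp [h]
  simp_rw [e]
  rw [lintegral_indicator_const measurableSet_Iic, Measure.restrict_apply measurableSet_Iic,
    Set.inter_comm, Set.Ici_inter_Iic, Real.volume_Icc, sub_zero, mul_comm]
  simp [ENNReal.smul_def]

lemma arrivalIntensity_le_ne_top [IsProbabilityMeasure f] (t : ℝ) :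
    arrivalIntensity Λ f {p | p.1 ≤ t} ≠ ∞ := by
  have h := lintegral_arrivalIntensity_of_le (Λ := Λ) (f := f) (φ := fun _ => 1)
    measurable_const t
  have e : (fun p : ℝ × ℝ × ℝ => if p.1 ≤ t then (1 : ℝ≥0∞) else 0) =
      {p : ℝ × ℝ × ℝ | p.1 ≤ t}.indicator 1 := by
    ext p
    simp [Set.indicator_apply]
  rw [e, lintegral_indicator_one (measurableSet_le measurable_fst measurable_const)] at h
  rw [h, lintegral_one, measure_univ, mul_one]
  finiteness

lemma arrivalIntensity_neg [SFinite f] : arrivalIntensity Λ f {p | p.1 < 0} = 0 := by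
  have : {p : ℝ × ℝ × ℝ | p.1 < 0} = Set.Iio 0 ×ˢ Set.univ := by ext; simp
  rw [this, arrivalIntensity, Measure.smul_apply, Measure.prod_prod,
    Measure.restrict_apply measurableSet_Iio]
  simp [Set.Iio_inter_Ici]

lemma arrivalIntensity_demand_neg [SFinite f] (hf : ∀ᵐ p ∂f, 0 ≤ p.1 ∧ p.1 ≤ p.2) :
    arrivalIntensity Λ f {p | p.2.1 < 0} = 0 := by
  have : {p : ℝ × ℝ × ℝ | p.2.1 < 0} = Set.univ ×ˢ {q : ℝ × ℝ | q.1 < 0} := by ext; simp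
  rw [this, arrivalIntensity, Measure.smul_apply, Measure.prod_prod]
  have h0 : f {q : ℝ × ℝ | q.1 < 0} = 0 := by
    refine measure_mono_null ?_ (ae_iff.1 hf)
    intro q hq h
    exact absurd h.1 (not_le.2 hq)
  simp [h0]

end Intensity

namespace IsPoissonArrivals

variable {Ω : Type*} [MeasurableSpace Ω] {μ : Measure Ω} {Λ : ℝ≥0} {f : Measure (ℝ × ℝ)}
  {job : ℕ → Ω → ℝ × ℝ × ℝ}

/-- A count with mean zero vanishes almost surely. This excludes negative arrival times and negative
demands, which the law of the process rules out only up to null sets. -/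
lemma ae_forall_notMem (h : IsPoissonArrivals μ Λ f job) {B : Set (ℝ × ℝ × ℝ)}
    (hB : MeasurableSet B) (h0 : arrivalIntensity Λ f B = 0) : ∀ᵐ ω ∂μ, ∀ k, job k ω ∉ B := by
  have h1 := h.lintegral_count hB (by simp [h0])
  rw [h0, lintegral_eq_zero_iff (measurable_jobProcess_apply h.measurable_job hB)] at h1
  filter_upwards [h1] with ω hω k hk
  rw [jobProcess_apply ω hB] at hω
  have := ENNReal.tsum_eq_zero.1 hω k
  simp [hk] at this

/-- The expected number of arrivals up to each integer is finite; monotonicity in t then gives one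
null set for all real t. -/
lemma ae_finite [IsProbabilityMeasure f] (h : IsPoissonArrivals μ Λ f job) :
    ∀ᵐ ω ∂μ, ∀ t, {k | (job k ω).1 ≤ t}.Finite := by
  have h1 : ∀ᵐ ω ∂μ, ∀ n : ℕ, {k | (job k ω).1 ≤ n}.Finite := by
    rw [ae_all_iff]
    intro n
    have hB : MeasurableSet {p : ℝ × ℝ × ℝ | p.1 ≤ n} :=
      measurableSet_le measurable_fst measurable_const
    have h2 := h.lintegral_count hB (arrivalIntensity_le_ne_top n)
    filter_upwards [ae_lt_top (measurable_jobProcess_apply h.measurable_job hB)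
      (h2 ▸ arrivalIntensity_le_ne_top n)] with ω hω
    rw [jobProcess_apply ω hB] at hω
    refine (ENNReal.finite_const_le_of_tsum_ne_top hω.ne one_ne_zero).subset fun k hk => ?_
    have : job k ω ∈ {p : ℝ × ℝ × ℝ | p.1 ≤ n} := hk
    simp [Set.indicator_of_mem this]
  filter_upwards [h1] with ω hω t
  obtain ⟨n, hn⟩ := exists_nat_ge t
  exact (hω n).subset fun k hk => le_trans hk hn

end IsPoissonArrivals

/-! ### Moments and increments of the arrived work. -/

section ArrivedWork

variable {Ω : Type*} {job : ℕ → Ω → ℝ × ℝ × ℝ}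

lemma arrivedWork_eq_lintegral (t : ℝ) (ω : Ω) :
    arrivedWork job t ω = ∫⁻ p, (if p.1 ≤ t then ENNReal.ofReal p.2.1 else 0) ∂(jobProcess job ω) :=
  (lintegral_jobProcess ω fun p => if p.1 ≤ t then ENNReal.ofReal p.2.1 else 0).symm

lemma measurable_workUpTo (t : ℝ) :
    Measurable fun p : ℝ × ℝ × ℝ => if p.1 ≤ t then ENNReal.ofReal p.2.1 else 0 :=
  Measurable.ite (measurableSet_le measurable_fst measurable_const) (by fun_prop) measurable_const

lemma measurable_arrivedWork [MeasurableSpace Ω] (hjob : ∀ k, Measurable (job k)) :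
    Measurable (Function.uncurry (arrivedWork job)) := by
  refine Measurable.tsum fun k => ?_
  have hk : Measurable fun z : ℝ × Ω => job k z.2 := (hjob k).comp measurable_snd
  refine Measurable.ite (measurableSet_le hk.fst measurable_fst) (by fun_prop) measurable_const

lemma arrivedWork_mono (ω : Ω) : Monotone fun t => arrivedWork job t ω := by
  intro s t hst
  refine ENNReal.tsum_le_tsum fun k => ?_
  split_ifs with h1 h2
  · exact le_rfl
  · exact absurd (h1.trans hst) h2
  · exact zero_le
  · exact le_rfl

lemma arrivedWork_add {s t : ℝ} (hst : s ≤ t) (ω : Ω) :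
    arrivedWork job t ω = arrivedWork job s ω +
      ∫⁻ p, (if s < p.1 ∧ p.1 ≤ t then ENNReal.ofReal p.2.1 else 0) ∂(jobProcess job ω) := by
  rw [lintegral_jobProcess, arrivedWork, arrivedWork, ← ENNReal.tsum_add]
  refine tsum_congr fun k => ?_
  by_cases h1 : (job k ω).1 ≤ s
  · simp [h1, h1.trans hst, not_lt.2 h1]
  · simp [h1, not_le.1 h1]

variable [MeasurableSpace Ω] {μ : Measure Ω} {Λ : ℝ≥0} {f : Measure (ℝ × ℝ)}

lemma lintegral_arrivedWork [IsProbabilityMeasure f] (h : IsPoissonArrivals μ Λ f job) (t : ℝ) :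
    ∫⁻ ω, arrivedWork job t ω ∂μ =
      Λ * (ENNReal.ofReal t * ∫⁻ q, ENNReal.ofReal q.1 ∂f) := by
  simp_rw [arrivedWork_eq_lintegral]
  rw [h.lintegral_poissonIntegral (S := {p | p.1 ≤ t})
    (measurableSet_le measurable_fst measurable_const) (arrivalIntensity_le_ne_top t)
    (measurable_workUpTo t) (fun p hp => if_neg hp)]
  exact lintegral_arrivalIntensity_of_le (φ := fun q => ENNReal.ofReal q.1) (by fun_prop) t

lemma lintegral_arrivedWork_sq [IsProbabilityMeasure f] (h : IsPoissonArrivals μ Λ f job) (t : ℝ) :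
    ∫⁻ ω, arrivedWork job t ω ^ 2 ∂μ =
      Λ * (ENNReal.ofReal t * ∫⁻ q, ENNReal.ofReal q.1 ^ 2 ∂f) +
        (∫⁻ ω, arrivedWork job t ω ∂μ) ^ 2 := by
  rw [lintegral_arrivedWork h]
  simp_rw [arrivedWork_eq_lintegral]
  rw [h.lintegral_poissonIntegral_sq (S := {p | p.1 ≤ t})
    (measurableSet_le measurable_fst measurable_const) (arrivalIntensity_le_ne_top t)
    (measurable_workUpTo t) (fun p hp => if_neg hp)]
  have e : ∀ p : ℝ × ℝ × ℝ, (if p.1 ≤ t then ENNReal.ofReal p.2.1 else 0) ^ 2 =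
      if p.1 ≤ t then ENNReal.ofReal p.2.1 ^ 2 else 0 := by
    intro p
    split_ifs <;> simp
  simp_rw [e]
  rw [lintegral_arrivalIntensity_of_le (φ := fun q => ENNReal.ofReal q.1) (by fun_prop) t,
    lintegral_arrivalIntensity_of_le (φ := fun q => ENNReal.ofReal q.1 ^ 2) (by fun_prop) t]

lemma lintegral_mul_arrivedWork_increment [IsProbabilityMeasure μ] [IsProbabilityMeasure f]
    (h : IsPoissonArrivals μ Λ f job) {s : ℝ} (t : ℝ) {Z : Ω → ℝ≥0∞}
    (hZ : Measurable[history job s] Z) :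
    ∫⁻ ω, Z ω * ∫⁻ p, (if s < p.1 ∧ p.1 ≤ t then ENNReal.ofReal p.2.1 else 0)
        ∂(jobProcess job ω) ∂μ =
      (∫⁻ ω, Z ω ∂μ) * ∫⁻ ω, ∫⁻ p, (if s < p.1 ∧ p.1 ≤ t then ENNReal.ofReal p.2.1 else 0)
        ∂(jobProcess job ω) ∂μ := by
  have hS : MeasurableSet {p : ℝ × ℝ × ℝ | s < p.1 ∧ p.1 ≤ t} :=
    (measurableSet_lt measurable_const measurable_fst).inter
      (measurableSet_le measurable_fst measurable_const)
  have hfin : arrivalIntensity Λ f {p : ℝ × ℝ × ℝ | s < p.1 ∧ p.1 ≤ t} ≠ ∞ :=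
    measure_ne_top_of_subset (fun p hp => hp.2) (arrivalIntensity_le_ne_top t)
  have hg : Measurable fun p : ℝ × ℝ × ℝ =>
      if s < p.1 ∧ p.1 ≤ t then ENNReal.ofReal p.2.1 else 0 :=
    Measurable.ite hS (by fun_prop) measurable_const
  rw [h.lintegral_history_mul s hS hfin (fun p hp => hp.1) hZ hg fun p hp => if_neg hp,
    h.lintegral_poissonIntegral hS hfin hg fun p hp => if_neg hp]

end ArrivedWork

namespace IsCentralizedPolicy

variable {Ω : Type*} [MeasurableSpace Ω] {μ : Measure Ω} {job : ℕ → Ω → ℝ × ℝ × ℝ}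
  {u : ℕ → ℝ → Set (ℕ × JobRecord) → ℝ} {r : ℕ → ℝ → Ω → ℝ}

lemma measurable_totalRate (hr : IsCentralizedPolicy μ job u r) :
    Measurable (Function.uncurry (totalRate r)) :=
  Measurable.tsum fun k => (hr.measurable_rate k).ennreal_ofReal

/-- The total service rate is determined by the history. -/
lemma exists_measurable_history_totalRate (hr : IsCentralizedPolicy μ job u r) (t : ℝ) :
    ∃ Z : Ω → ℝ≥0∞, Measurable[history job t] Z ∧ totalRate r t =ᵐ[μ] Z := by
  -- Each rate has only an almost everywhere equal history-measurable version; countably many jobs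
  -- leave a single null set.
  refine ⟨fun ω => ∑' k, ENNReal.ofReal ((hr.online k t).mk _ ω), ?_, ?_⟩
  · exact @Measurable.tsum Ω _ _ (history job t) _ _ _ _ _ _ _ _ _ _ _ _ fun k =>
      ((hr.online k t).stronglyMeasurable_mk.measurable).ennreal_ofReal
  · have : ∀ᵐ ω ∂μ, ∀ k, r k t ω = (hr.online k t).mk _ ω :=
      ae_all_iff.2 fun k => (hr.online k t).ae_eq_mk
    filter_upwards [this] with ω hω
    exact tsum_congr fun k => by rw [hω k]

end IsCentralizedPolicy

/-! ### From the energy inequality to long-run averages. -/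

lemma lintegral_Icc_le_of_average_lt {v : ℝ → ℝ≥0∞} {V : ℝ≥0∞} {b : ℝ}
    (h : Tendsto (fun T : ℝ => (∫⁻ t in Set.Icc 0 T, v t) / ENNReal.ofReal T) atTop (𝓝 V))
    (hb : V < ENNReal.ofReal b) :
    ∀ᶠ T in atTop, ∫⁻ t in Set.Icc 0 T, v t ≤ ENNReal.ofReal (b * T) := by
  filter_upwards [h.eventually_lt_const hb, eventually_gt_atTop 0] with T hT hT0
  rw [ENNReal.ofReal_mul' hT0.le]
  exact (ENNReal.div_le_iff (by simpa using hT0) ENNReal.ofReal_ne_top).1 hT.le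

/-- An averaged energy inequality yields a lower bound on the product of the averages. -/
lemma ofReal_sq_div_le_of_energy {v w : ℝ → ℝ≥0∞} {V W : ℝ≥0∞} {a D : ℝ} (ha : 0 ≤ a) (hD : 0 < D)
    (hv : Tendsto (fun T : ℝ => (∫⁻ t in Set.Icc 0 T, v t) / ENNReal.ofReal T) atTop (𝓝 V))
    (hw : Tendsto (fun T : ℝ => (∫⁻ t in Set.Icc 0 T, w t) / ENNReal.ofReal T) atTop (𝓝 W))
    (hV : V ≤ ENNReal.ofReal D)
    (henergy : ∀ c : ℝ, 0 < c → ∀ T : ℝ, 0 ≤ T → ENNReal.ofReal (a * T) ≤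
      v T + ENNReal.ofReal c * (∫⁻ t in Set.Icc 0 T, v t) +
        ENNReal.ofReal c⁻¹ * ∫⁻ t in Set.Icc 0 T, w t) :
    ENNReal.ofReal (a ^ 2 / (4 * D)) ≤ W := by
  rcases ha.eq_or_lt with rfl | ha
  · simp
  by_contra! hlt
  obtain ⟨x, hx0, rfl⟩ : ∃ x : ℝ, 0 ≤ x ∧ W = ENNReal.ofReal x :=
    ⟨W.toReal, ENNReal.toReal_nonneg, (ENNReal.ofReal_toReal hlt.ne_top).symm⟩
  rw [ENNReal.ofReal_lt_ofReal_iff (by positivity)] at hlt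
  -- This `c` maximises c(a - cD), with maximum a²/(4D).
  set c : ℝ := a / (2 * D) with hc
  have hc0 : 0 < c := by positivity
  have hcD : c * D = a / 2 := by
    rw [hc]
    field_simp
  have hcx : c⁻¹ * x < a / 2 := by
    have : c⁻¹ * x < c⁻¹ * (a ^ 2 / (4 * D)) := by gcongr
    refine this.trans_eq ?_
    rw [hc]
    field_simp
    ring
  -- The gap a - cD - c⁻¹x is split into four equal parts δ: one for each average to exceed its
  -- limit strictly, and two left over to force growth of `v`.
  obtain ⟨δ, hδ0, hδ⟩ : ∃ δ : ℝ, 0 < δ ∧ a = c * (D + δ / c) + c⁻¹ * (x + c * δ) + 2 * δ := by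
    refine ⟨(a / 2 - c⁻¹ * x) / 4, by linarith, ?_⟩
    have e1 : ∀ δ : ℝ, c * (D + δ / c) + c⁻¹ * (x + c * δ) + 2 * δ =
        c * D + c⁻¹ * x + 4 * δ := by
      intro δ
      field_simp
      ring
    rw [e1, hcD]
    ring
  set D' := D + δ / c with hD'
  have hD'0 : 0 < D' := by positivity
  have hV' := lintegral_Icc_le_of_average_lt hv (b := D')
    (hV.trans_lt (by rw [ENNReal.ofReal_lt_ofReal_iff hD'0, hD']; linarith [div_pos hδ0 hc0]))
  have hW' := lintegral_Icc_le_of_average_lt hw (b := x + c * δ)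
    (by rw [ENNReal.ofReal_lt_ofReal_iff (by positivity)]; linarith [mul_pos hc0 hδ0])
  obtain ⟨T₀, hT₀⟩ := eventually_atTop.1 ((hV'.and hW').and (eventually_ge_atTop 0))
  have hgrow : ∀ T, T₀ ≤ T → ENNReal.ofReal (2 * δ * T) ≤ v T := by
    intro T hT
    obtain ⟨⟨h1, h2⟩, h0⟩ := hT₀ T hT
    have h3 : ENNReal.ofReal (2 * δ * T) + ENNReal.ofReal ((a - 2 * δ) * T) ≤
        v T + ENNReal.ofReal ((a - 2 * δ) * T) := by
      have e : a - 2 * δ = c * D' + c⁻¹ * (x + c * δ) := by linarith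
      have hpos : 0 ≤ a - 2 * δ := by rw [e]; positivity
      rw [← ENNReal.ofReal_add (by positivity) (by positivity),
        show 2 * δ * T + (a - 2 * δ) * T = a * T by ring]
      refine (henergy c hc0 T h0).trans ?_
      rw [add_assoc]
      refine add_le_add le_rfl ?_
      have e2 : (a - 2 * δ) * T = c * (D' * T) + c⁻¹ * ((x + c * δ) * T) := by rw [e]; ring
      rw [e2, ENNReal.ofReal_add (by positivity) (by positivity), ENNReal.ofReal_mul hc0.le,
        ENNReal.ofReal_mul (inv_nonneg.2 hc0.le)]
      gcongr
    exact (ENNReal.add_le_add_iff_right ENNReal.ofReal_ne_top).1 h3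
  -- On [T/2, T] one has v ≥ δT, so the integral of v is at least δT²/2. The choice of T makes this
  -- exceed the linear bound D'T.
  set T := max (2 * max T₀ 0) (2 * D' / δ + 1) with hT
  have hT1 : 2 * max T₀ 0 ≤ T := le_max_left _ _
  have hT2 : 2 * D' / δ + 1 ≤ T := le_max_right _ _
  have hTpos : 0 < T := lt_of_lt_of_le (by positivity) hT2
  have hT3 : T₀ ≤ T / 2 := by linarith [le_max_left T₀ 0]
  have hlow : ENNReal.ofReal (δ * T * (T / 2)) ≤ ∫⁻ t in Set.Icc 0 T, v t := by
    calc ENNReal.ofReal (δ * T * (T / 2))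
        = ∫⁻ _ in Set.Icc (T / 2) T, ENNReal.ofReal (δ * T) := by
          rw [setLIntegral_const, Real.volume_Icc, ← ENNReal.ofReal_mul (by positivity)]
          congr 1
          ring
      _ ≤ ∫⁻ t in Set.Icc (T / 2) T, v t := by
          refine setLIntegral_mono' measurableSet_Icc fun t ht => ?_
          refine le_trans (ENNReal.ofReal_le_ofReal ?_) (hgrow t (hT3.trans ht.1))
          nlinarith [ht.1]
      _ ≤ ∫⁻ t in Set.Icc 0 T, v t :=
          lintegral_mono_set (Set.Icc_subset_Icc_left (by positivity))
  have hup := (hT₀ T (by linarith)).1.1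
  have := (ENNReal.ofReal_le_ofReal_iff (by positivity)).1 (hlow.trans hup)
  have h5 : 2 * D' < δ * T := by
    have : 2 * D' / δ < T := by linarith
    rw [div_lt_iff₀ hδ0] at this
    linarith
  nlinarith

section Centered

variable {Ω : Type*} [MeasurableSpace Ω] {μ : Measure Ω}

/-- The factorisation itself makes FG integrable, so finite means suffice and neither factor needs a
second moment. -/
lemma integral_centered_mul_eq_zero [IsProbabilityMeasure μ] {F G : Ω → ℝ≥0∞} (hF : Measurable F)
    (hG : Measurable G) (hF' : ∫⁻ ω, F ω ∂μ ≠ ∞) (hG' : ∫⁻ ω, G ω ∂μ ≠ ∞)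
    (hFG : ∫⁻ ω, F ω * G ω ∂μ = (∫⁻ ω, F ω ∂μ) * ∫⁻ ω, G ω ∂μ) :
    ∫ ω, ((G ω).toReal - ∫ ω', (G ω').toReal ∂μ) *
      ((F ω).toReal - ∫ ω', (F ω').toReal ∂μ) ∂μ = 0 := by
  have iF : Integrable (fun ω => (F ω).toReal) μ := integrable_toReal_of_lintegral_ne_top
    hF.aemeasurable hF'
  have iG : Integrable (fun ω => (G ω).toReal) μ := integrable_toReal_of_lintegral_ne_top
    hG.aemeasurable hG'
  have hFG' : ∫⁻ ω, F ω * G ω ∂μ ≠ ∞ := by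
    rw [hFG]
    exact ENNReal.mul_ne_top hF' hG'
  have iFG : Integrable (fun ω => (F ω).toReal * (G ω).toReal) μ := by
    simpa [ENNReal.toReal_mul] using
      integrable_toReal_of_lintegral_ne_top (hF.mul hG).aemeasurable hFG'
  have e1 : ∫ ω, (F ω).toReal * (G ω).toReal ∂μ =
      (∫ ω, (F ω).toReal ∂μ) * ∫ ω, (G ω).toReal ∂μ := by
    have := integral_toReal (hF.mul hG).aemeasurable (ae_lt_top (hF.mul hG) hFG')
    simp only [Pi.mul_apply, ENNReal.toReal_mul] at this
    rw [this, hFG, ENNReal.toReal_mul, integral_toReal hF.aemeasurable (ae_lt_top hF hF'),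
      integral_toReal hG.aemeasurable (ae_lt_top hG hG')]
  set a := ∫ ω, (F ω).toReal ∂μ
  set b := ∫ ω, (G ω).toReal ∂μ
  have e2 : ∀ ω, ((G ω).toReal - b) * ((F ω).toReal - a) =
      (F ω).toReal * (G ω).toReal - b * (F ω).toReal - a * (G ω).toReal + a * b := by
    intro ω
    ring
  simp_rw [e2]
  rw [integral_add (by fun_prop) (by fun_prop), integral_sub (by fun_prop) (by fun_prop),
    integral_sub (by fun_prop) (by fun_prop),
    integral_const_mul, integral_const_mul, e1]
  simp [a, b]
  ring

end Centered

/-! ### The energy inequality for an online policy. -/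

section Policy

variable {Ω : Type*} [MeasurableSpace Ω] {μ : Measure Ω} {Λ : ℝ≥0}
  {f : Measure (ℝ × ℝ)}
  {job : ℕ → Ω → ℝ × ℝ × ℝ}
  {u : ℕ → ℝ → Set (ℕ × JobRecord) → ℝ} {r : ℕ → ℝ → Ω → ℝ}

lemma lintegral_ofReal_ne_top_of_memLp [IsProbabilityMeasure f]
    (hσ : MemLp (fun p : ℝ × ℝ => p.1) 2 f) : ∫⁻ q, ENNReal.ofReal q.1 ∂f ≠ ∞ :=
  ((hasFiniteIntegral_iff_enorm.1 (hσ.integrable one_le_two).2).trans_le' (by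
    refine lintegral_mono fun q => ?_
    exact Real.ofReal_le_enorm _)).ne

lemma lintegral_ofReal_sq_eq (hf : ∀ᵐ p ∂f, 0 ≤ p.1 ∧ p.1 ≤ p.2)
    (hσ : MemLp (fun p : ℝ × ℝ => p.1) 2 f) :
    ∫⁻ q, ENNReal.ofReal q.1 ^ 2 ∂f = ENNReal.ofReal (∫ q, q.1 ^ 2 ∂f) := by
  rw [← lintegral_ofReal_sq hσ]
  refine lintegral_congr_ae ?_
  filter_upwards [hf] with q hq
  rw [ENNReal.ofReal_pow hq.1]

lemma lintegral_arrivedWork_ne_top [IsProbabilityMeasure f] (h : IsPoissonArrivals μ Λ f job)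
    (hσ : MemLp (fun p : ℝ × ℝ => p.1) 2 f) (t : ℝ) : ∫⁻ ω, arrivedWork job t ω ∂μ ≠ ∞ := by
  rw [lintegral_arrivedWork h]
  have := lintegral_ofReal_ne_top_of_memLp hσ
  exact ENNReal.mul_ne_top ENNReal.coe_ne_top (ENNReal.mul_ne_top ENNReal.ofReal_ne_top this)

lemma measurable_arrivedWork_apply (h : IsPoissonArrivals μ Λ f job) (t : ℝ) :
    Measurable (arrivedWork job t) :=
  (measurable_arrivedWork h.measurable_job).comp (by fun_prop : Measurable fun ω => (t, ω))

lemma measurable_totalRate_apply (hr : IsCentralizedPolicy μ job u r) (t : ℝ) :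
    Measurable (totalRate r t) :=
  hr.measurable_totalRate.comp (by fun_prop : Measurable fun ω => (t, ω))

lemma memLp_arrivedWork [IsProbabilityMeasure μ] [IsProbabilityMeasure f]
    (h : IsPoissonArrivals μ Λ f job)
    (hf : ∀ᵐ p ∂f, 0 ≤ p.1 ∧ p.1 ≤ p.2)
    (hσ : MemLp (fun p : ℝ × ℝ => p.1) 2 f) (t : ℝ) :
    MemLp (fun ω => (arrivedWork job t ω).toReal) 2 μ := by
  refine memLp_two_of_lintegral_ofReal_sq
    (measurable_arrivedWork_apply h t).ennreal_toReal.aestronglyMeasurable ?_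
  have h2 := lintegral_arrivedWork_sq h t
  rw [lintegral_ofReal_sq_eq hf hσ] at h2
  refine ne_top_of_le_ne_top (b := ∫⁻ ω, arrivedWork job t ω ^ 2 ∂μ) ?_ ?_
  · rw [h2]
    have := lintegral_arrivedWork_ne_top h hσ t
    finiteness
  · refine lintegral_mono fun ω => ?_
    rw [ENNReal.ofReal_pow ENNReal.toReal_nonneg]
    gcongr
    exact ENNReal.ofReal_toReal_le

/-- The work arrived up to time `t` has variance `Λ t 𝔼[σ²]`. -/
lemma lintegral_centered_arrivedWork_sq [IsProbabilityMeasure μ] [IsProbabilityMeasure f]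
    (h : IsPoissonArrivals μ Λ f job)
    (hf : ∀ᵐ p ∂f, 0 ≤ p.1 ∧ p.1 ≤ p.2)
    (hσ : MemLp (fun p : ℝ × ℝ => p.1) 2 f) {t : ℝ} (ht : 0 ≤ t) :
    ∫⁻ ω, ENNReal.ofReal (((arrivedWork job t ω).toReal -
      ∫ ω', (arrivedWork job t ω').toReal ∂μ) ^ 2) ∂μ =
      ENNReal.ofReal (Λ * (∫ q, q.1 ^ 2 ∂f) * t) := by
  have hm := measurable_arrivedWork_apply h t
  have hfin := ae_lt_top hm (lintegral_arrivedWork_ne_top h hσ t)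
  rw [← evariance_eq_lintegral_ofReal, evariance_def' hm.ennreal_toReal.aestronglyMeasurable]
  have e1 : ∫⁻ ω, ‖(arrivedWork job t ω).toReal‖ₑ ^ 2 ∂μ = ∫⁻ ω, arrivedWork job t ω ^ 2 ∂μ := by
    refine lintegral_congr_ae ?_
    filter_upwards [hfin] with ω hω
    rw [Real.enorm_of_nonneg ENNReal.toReal_nonneg, ENNReal.ofReal_toReal hω.ne]
  have hne := lintegral_arrivedWork_ne_top h hσ t
  rw [e1, integral_toReal hm.aemeasurable hfin, ENNReal.ofReal_pow ENNReal.toReal_nonneg,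
    ENNReal.ofReal_toReal hne, lintegral_arrivedWork_sq h t, ENNReal.add_sub_cancel_right
      (ENNReal.pow_ne_top hne), lintegral_ofReal_sq_eq hf hσ, ENNReal.ofReal_mul' ht,
    ENNReal.ofReal_mul Λ.coe_nonneg, ENNReal.ofReal_coe_nnreal]
  ring

/-- One null set serves all times, which lets the balance equation be combined with integration in
time. -/
lemma ae_regular [IsProbabilityMeasure f] (h : IsPoissonArrivals μ Λ f job)
    (hr : IsCentralizedPolicy μ job u r) (hf : ∀ᵐ p ∂f, 0 ≤ p.1 ∧ p.1 ≤ p.2) :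
    ∀ᵐ ω ∂μ, (∀ t, totalRate r t ω ≠ ∞ ∧
      serviceCapacity r t ω = (totalRate r t ω).toReal ∧ arrivedWork job t ω ≠ ∞) ∧
      ∀ t, 0 ≤ t → IntervalIntegrable (fun s => (totalRate r s ω).toReal) volume 0 t ∧
        totalRemainingDemand job r t ω =
          (arrivedWork job t ω).toReal - ∫ s in (0 : ℝ)..t, (totalRate r s ω).toReal := by
  filter_upwards [hr.nonneg, hr.locallyIntegrable, hr.eq_zero_of_lt, h.ae_finite,
    h.ae_forall_notMem (measurableSet_lt measurable_fst measurable_const) arrivalIntensity_neg,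
    h.ae_forall_notMem (measurableSet_lt (by fun_prop) measurable_const)
      (arrivalIntensity_demand_neg hf)] with ω hnn hloc hz hfin ha hs
  have ha' : ∀ k, 0 ≤ (job k ω).1 := fun k => not_lt.1 (ha k)
  have hs' : ∀ k, 0 ≤ (job k ω).2.1 := fun k => not_lt.1 (hs k)
  refine ⟨fun t => ⟨totalRate_ne_top hz (hfin t), serviceCapacity_eq hnn hz (hfin t), ?_⟩,
    fun t ht => ⟨intervalIntegrable_totalRate hnn hloc hz ht (hfin t),
      totalRemainingDemand_eq hnn hloc hz ht (hfin t) ha' hs'⟩⟩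
  rw [arrivedWork_eq_sum (hfin t)]
  exact ENNReal.sum_ne_top.2 fun _ _ => ENNReal.ofReal_ne_top

lemma evariance_serviceCapacity [IsProbabilityMeasure μ] [IsProbabilityMeasure f]
    (h : IsPoissonArrivals μ Λ f job)
    (hr : IsCentralizedPolicy μ job u r) (hf : ∀ᵐ p ∂f, 0 ≤ p.1 ∧ p.1 ≤ p.2) (t : ℝ) :
    evariance (serviceCapacity r t) μ =
      ∫⁻ ω, ENNReal.ofReal (((totalRate r t ω).toReal -
        ∫ ω', (totalRate r t ω').toReal ∂μ) ^ 2) ∂μ := by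
  rw [← evariance_eq_lintegral_ofReal]
  refine evariance_congr ?_
  filter_upwards [ae_regular h hr hf] with ω hω using (hω.1 t).2.1

/-- A square integrable remaining demand forces the expected service to be finite. -/
lemma lintegral_totalRate_ne_top [IsProbabilityMeasure μ] [IsProbabilityMeasure f]
    (h : IsPoissonArrivals μ Λ f job)
    (hr : IsCentralizedPolicy μ job u r) (hf : ∀ᵐ p ∂f, 0 ≤ p.1 ∧ p.1 ≤ p.2)
    (hσ : MemLp (fun p : ℝ × ℝ => p.1) 2 f) {t : ℝ} (ht : 0 ≤ t)
    (hX : evariance (totalRemainingDemand job r t) μ ≠ ∞) :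
    ∫⁻ s in Set.Icc 0 t, ∫⁻ ω, totalRate r s ω ∂μ ≠ ∞ := by
  have hreg := ae_regular h hr hf
  have hPm : Measurable (Function.uncurry fun s ω => (totalRate r s ω).toReal) :=
    hr.measurable_totalRate.ennreal_toReal
  have hIm : Measurable fun ω => ∫ s in (0 : ℝ)..t, (totalRate r s ω).toReal :=
    (measurable_uncurry_primitive hPm).comp (by fun_prop : Measurable fun ω => (t, ω))
  have hJ := memLp_arrivedWork h hf hσ t
  have hXae : totalRemainingDemand job r t =ᵐ[μ] fun ω => (arrivedWork job t ω).toReal -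
      ∫ s in (0 : ℝ)..t, (totalRate r s ω).toReal := by
    filter_upwards [hreg] with ω hω using (hω.2 t ht).2
  rw [evariance_congr hXae, ← lt_top_iff_ne_top, evariance_lt_top_iff_memLp
    ((measurable_arrivedWork_apply h t).ennreal_toReal.fun_sub hIm).aestronglyMeasurable] at hX
  -- The service delivered is J(t) - X(t), a difference of square integrable variables.
  have hI : Integrable (fun ω => ∫ s in (0 : ℝ)..t, (totalRate r s ω).toReal) μ := by
    have := (hJ.sub hX).integrable one_le_two
    refine this.congr (ae_of_all _ fun ω => ?_)
    simp
  rw [lintegral_lintegral_swap hr.measurable_totalRate.aemeasurable]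
  have e : ∀ᵐ ω ∂μ, ∫⁻ s in Set.Icc 0 t, totalRate r s ω =
      ENNReal.ofReal (∫ s in (0 : ℝ)..t, (totalRate r s ω).toReal) := by
    filter_upwards [hreg] with ω hω
    rw [intervalIntegral.integral_of_le ht, ← integral_Icc_eq_integral_Ioc,
      ofReal_integral_eq_lintegral_ofReal
        ((intervalIntegrable_iff_integrableOn_Icc_of_le ht).1 (hω.2 t ht).1)
        (ae_of_all _ fun _ => ENNReal.toReal_nonneg)]
    exact lintegral_congr fun s => (ENNReal.ofReal_toReal (hω.1 s).1).symm
  rw [lintegral_congr_ae e]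
  exact (hasFiniteIntegral_iff_ofReal (ae_of_all _ fun ω =>
    intervalIntegral.integral_nonneg ht fun _ _ => ENNReal.toReal_nonneg)).1 hI.2 |>.ne

/-- Finite expected total service permits Fubini, so centring the integral of P amounts to centring
P at each time. -/
lemma evariance_totalRemainingDemand [IsProbabilityMeasure μ] [IsProbabilityMeasure f]
    (h : IsPoissonArrivals μ Λ f job)
    (hr : IsCentralizedPolicy μ job u r) (hf : ∀ᵐ p ∂f, 0 ≤ p.1 ∧ p.1 ≤ p.2)
    (hσ : MemLp (fun p : ℝ × ℝ => p.1) 2 f) {t : ℝ} (ht : 0 ≤ t)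
    (hfin : ∫⁻ s in Set.Icc 0 t, ∫⁻ ω, totalRate r s ω ∂μ ≠ ∞) :
    evariance (totalRemainingDemand job r t) μ =
      ∫⁻ ω, ENNReal.ofReal (((arrivedWork job t ω).toReal -
        ∫ ω', (arrivedWork job t ω').toReal ∂μ - ∫ s in (0 : ℝ)..t, ((totalRate r s ω).toReal -
          ∫ ω', (totalRate r s ω').toReal ∂μ)) ^ 2) ∂μ := by
  have hreg := ae_regular h hr hf
  set P : ℝ → Ω → ℝ := fun s ω => (totalRate r s ω).toReal with hP
  set ν := (volume : Measure ℝ).restrict (Set.Icc 0 t) with hν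
  have hPi : Integrable (fun z : ℝ × Ω => P z.1 z.2) (ν.prod μ) := by
    refine integrable_toReal_of_lintegral_ne_top (f := fun z : ℝ × Ω => totalRate r z.1 z.2)
      hr.measurable_totalRate.aemeasurable ?_
    exact (lintegral_prod _ hr.measurable_totalRate.aemeasurable).trans_ne hfin
  have hIcc : ∀ g : ℝ → ℝ, ∫ s in (0 : ℝ)..t, g s = ∫ s, g s ∂ν := by
    intro g
    rw [intervalIntegral.integral_of_le ht, hν, integral_Icc_eq_integral_Ioc]
  have hq : Integrable (fun s => ∫ ω', P s ω' ∂μ) ν := hPi.integral_prod_left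
  have hI : Integrable (fun ω => ∫ s, P s ω ∂ν) μ := hPi.integral_prod_right
  have hJ : Integrable (fun ω => (arrivedWork job t ω).toReal) μ :=
    (memLp_arrivedWork h hf hσ t).integrable one_le_two
  have hXae : totalRemainingDemand job r t =ᵐ[μ] fun ω => (arrivedWork job t ω).toReal -
      ∫ s, P s ω ∂ν := by
    filter_upwards [hreg] with ω hω
    rw [← hIcc]
    exact (hω.2 t ht).2
  rw [evariance_congr hXae, evariance_eq_lintegral_ofReal, integral_sub hJ hI]
  refine lintegral_congr_ae ?_
  filter_upwards [hPi.prod_left_ae] with ω hω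
  have e1 : ∫ s in (0 : ℝ)..t, (P s ω - ∫ ω', P s ω' ∂μ) =
      ∫ s, P s ω ∂ν - ∫ s, ∫ ω', P s ω' ∂μ ∂ν := by
    rw [hIcc, integral_sub hω hq]
  have e2 : ∫ s, ∫ ω', P s ω' ∂μ ∂ν = ∫ ω', ∫ s, P s ω' ∂ν ∂μ := integral_integral_swap hPi
  rw [e1, e2]
  congr 2
  ring

/-- The energy inequality for the stationary variances. -/
lemma energy_inequality [IsProbabilityMeasure μ] [IsProbabilityMeasure f]
    (h : IsPoissonArrivals μ Λ f job)
    (hr : IsCentralizedPolicy μ job u r) (hf : ∀ᵐ p ∂f, 0 ≤ p.1 ∧ p.1 ≤ p.2)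
    (hσ : MemLp (fun p : ℝ × ℝ => p.1) 2 f) {T c : ℝ} (hT : 0 ≤ T) (hc : 0 < c)
    (hfin : ∫⁻ s in Set.Icc 0 T, ∫⁻ ω, totalRate r s ω ∂μ ≠ ∞) :
    ENNReal.ofReal (Λ * (∫ q, q.1 ^ 2 ∂f) * T) ≤
      evariance (totalRemainingDemand job r T) μ +
      ENNReal.ofReal c * (∫⁻ s in Set.Icc 0 T, evariance (totalRemainingDemand job r s) μ) +
      ENNReal.ofReal c⁻¹ * ∫⁻ s in Set.Icc 0 T, evariance (serviceCapacity r s) μ := by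
  -- If the variance of P has infinite integral, the right-hand side is infinite because c⁻¹ > 0;
  -- otherwise the centred P is square integrable on [0, T] × Ω.
  by_cases hVP : ∫⁻ s in Set.Icc 0 T, evariance (serviceCapacity r s) μ = ∞
  · rw [hVP, ENNReal.mul_top (by simpa using hc), add_top]
    exact le_top
  have hjm := h.measurable_job
  have hJm : Measurable (Function.uncurry fun t ω => (arrivedWork job t ω).toReal) :=
    (measurable_arrivedWork hjm).ennreal_toReal
  have hPm : Measurable (Function.uncurry fun t ω => (totalRate r t ω).toReal) :=
    hr.measurable_totalRate.ennreal_toReal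
  have hmean : ∀ {g : ℝ → Ω → ℝ}, Measurable (Function.uncurry g) →
      Measurable (Function.uncurry fun t ω => g t ω - ∫ ω', g t ω' ∂μ) := by
    intro g hg
    exact hg.sub ((hg.stronglyMeasurable.integral_prod_right').measurable.comp measurable_fst)
  simp_rw [evariance_serviceCapacity h hr hf] at hVP ⊢
  have hsub : ∀ s ∈ Set.Icc 0 T, ∫⁻ s in Set.Icc 0 s, ∫⁻ ω, totalRate r s ω ∂μ ≠ ∞ := fun s hs =>
    ne_top_of_le_ne_top hfin (lintegral_mono_set (Set.Icc_subset_Icc_right hs.2))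
  rw [setLIntegral_congr_fun measurableSet_Icc
    (fun s hs => evariance_totalRemainingDemand h hr hf hσ hs.1 (hsub s hs)),
    evariance_totalRemainingDemand h hr hf hσ hT hfin,
    ← lintegral_centered_arrivedWork_sq h hf hσ hT]
  have hJfin := lintegral_arrivedWork_ne_top h hσ
  have hJi : ∀ t, Integrable (fun ω => (arrivedWork job t ω).toReal) μ := fun t =>
    (memLp_arrivedWork h hf hσ t).integrable one_le_two
  refine lintegral_sq_le_of_uncorrelated hT hc
    (M := fun t ω => (arrivedWork job t ω).toReal - ∫ ω', (arrivedWork job t ω').toReal ∂μ)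
    (Y := fun t ω => (totalRate r t ω).toReal - ∫ ω', (totalRate r t ω').toReal ∂μ)
    (B := fun ω => (arrivedWork job T ω).toReal + ∫ ω', (arrivedWork job T ω').toReal ∂μ)
    (hmean hJm) ((memLp_arrivedWork h hf hσ T).add (memLp_const _)) ?_ (hmean hPm) hVP ?_
  -- Arrived work is nonnegative and increasing, so J(T) + 𝔼J(T) dominates |M(s)| for all s ≤ T at
  -- once.
  · have hmono : ∀ᵐ ω ∂μ, ∀ s ≤ T, (arrivedWork job s ω).toReal ≤ (arrivedWork job T ω).toReal := by
      filter_upwards [ae_regular h hr hf] with ω hω s hs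
      exact ENNReal.toReal_mono (hω.1 T).2.2 (arrivedWork_mono ω hs)
    filter_upwards [hmono] with ω hω s hs
    have h1 := hω s hs.2
    have h2 : ∫ ω', (arrivedWork job s ω').toReal ∂μ ≤ ∫ ω', (arrivedWork job T ω').toReal ∂μ :=
      integral_mono_ae (hJi s) (hJi T) (by filter_upwards [hmono] with ω' hω' using hω' s hs.2)
    have h3 : 0 ≤ ∫ ω', (arrivedWork job s ω').toReal ∂μ :=
      integral_nonneg fun _ => ENNReal.toReal_nonneg
    have h4 : 0 ≤ (arrivedWork job s ω).toReal := ENNReal.toReal_nonneg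
    rw [abs_le]
    constructor <;> linarith
  · have hPfin : ∀ᵐ s ∂volume.restrict (Set.Icc 0 T), ∫⁻ ω, totalRate r s ω ∂μ < ∞ :=
      ae_lt_top hr.measurable_totalRate.lintegral_prod_right' hfin
    filter_upwards [hPfin, ae_restrict_mem measurableSet_Icc] with s hs hsT
    -- `K` is the work arriving in (s, T]. The interval is open at s, so `K` involves no job already
    -- in the history at s.
    set K : Ω → ℝ≥0∞ := fun ω => ∫⁻ p, (if s < p.1 ∧ p.1 ≤ T then ENNReal.ofReal p.2.1 else 0)
      ∂(jobProcess job ω) with hK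
    have hKm : Measurable K := by
      refine measurable_lintegral_jobProcess hjm (Measurable.ite ?_ (by fun_prop) measurable_const)
      exact (measurableSet_lt measurable_const measurable_fst).inter
        (measurableSet_le measurable_fst measurable_const)
    have hadd : ∀ ω, arrivedWork job T ω = arrivedWork job s ω + K ω := arrivedWork_add hsT.2
    have hKfin : ∫⁻ ω, K ω ∂μ ≠ ∞ :=
      ne_top_of_le_ne_top (hJfin T) (lintegral_mono fun ω => by rw [hadd]; exact le_add_self)
    have hKae : ∀ᵐ ω ∂μ, (K ω).toReal =
        (arrivedWork job T ω).toReal - (arrivedWork job s ω).toReal := by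
      filter_upwards [ae_lt_top hKm hKfin, ae_regular h hr hf] with ω h1 h2
      rw [hadd, ENNReal.toReal_add (h2.1 s).2.2 h1.ne]
      ring
    have hKint : ∫ ω, (K ω).toReal ∂μ = ∫ ω, (arrivedWork job T ω).toReal ∂μ -
        ∫ ω, (arrivedWork job s ω).toReal ∂μ := by
      rw [integral_congr_ae hKae, integral_sub (hJi T) (hJi s)]
    obtain ⟨Z, hZm, hZ⟩ := hr.exists_measurable_history_totalRate s
    have hprod : ∫⁻ ω, totalRate r s ω * K ω ∂μ =
        (∫⁻ ω, totalRate r s ω ∂μ) * ∫⁻ ω, K ω ∂μ := by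
      rw [lintegral_congr_ae hZ, ← lintegral_mul_arrivedWork_increment h T hZm]
      refine lintegral_congr_ae ?_
      filter_upwards [hZ] with ω hω
      rw [hω]
    have h0 := integral_centered_mul_eq_zero (measurable_totalRate_apply hr s) hKm hs.ne hKfin hprod
    rw [← h0]
    refine integral_congr_ae ?_
    filter_upwards [hKae] with ω hω
    rw [hω, hKint]
    ring

end Policy

end DeadlineScheduling

theorem lemma5 {Ω : Type*} [MeasurableSpace Ω] (μ : Measure Ω) [IsProbabilityMeasure μ]
    (Λ : ℝ≥0) (hΛ : 0 < Λ)
    (f : Measure (ℝ × ℝ)) [IsProbabilityMeasure f]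
    (hf : ∀ᵐ p ∂f, 0 ≤ p.1 ∧ p.1 ≤ p.2)
    (hσ : MemLp (fun p : ℝ × ℝ => p.1) 2 f) (hτ : MemLp (fun p : ℝ × ℝ => p.2) 2 f)
    (job : ℕ → Ω → ℝ × ℝ × ℝ)
    (hjob : DeadlineScheduling.IsPoissonArrivals μ Λ f job)
    (u : ℕ → ℝ → Set (ℕ × DeadlineScheduling.JobRecord) → ℝ) (r : ℕ → ℝ → Ω → ℝ)
    (hr : DeadlineScheduling.IsCentralizedPolicy μ job u r)
    (VX VP : ℝ≥0∞)
    (hVX : DeadlineScheduling.IsStationaryVariance μ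
      (DeadlineScheduling.totalRemainingDemand job r) VX)
    (hVP : DeadlineScheduling.IsStationaryVariance μ (DeadlineScheduling.serviceCapacity r) VP)
    (D : ℝ) (hD : 0 < D) (hXD : VX ≤ ENNReal.ofReal D) :
    ENNReal.ofReal ((Λ : ℝ) ^ 2 * (∫ p, p.1 ^ 2 ∂f) ^ 2 / (4 * D)) ≤ VP := by
  have hfinite : ∀ T : ℝ, 0 ≤ T → ∫⁻ s in Set.Icc 0 T,
      ∫⁻ ω, DeadlineScheduling.totalRate r s ω ∂μ ≠ ∞ := by
    intro T hT
    -- Were Var X(t) infinite for all t ≥ T, its time averages would be infinite too, against Var(X)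
    -- ≤ D. One finite value beyond T bounds the expected service on [0, T].
    obtain ⟨t, ht, hXt⟩ : ∃ t, T ≤ t ∧
        evariance (DeadlineScheduling.totalRemainingDemand job r t) μ ≠ ∞ := by
      by_contra! hcon
      have h1 := DeadlineScheduling.lintegral_Icc_le_of_average_lt hVX (b := D + 1)
        (hXD.trans_lt (by rw [ENNReal.ofReal_lt_ofReal_iff (by linarith)]; linarith))
      obtain ⟨T', hT', hTT'⟩ := (h1.and (eventually_gt_atTop T)).exists
      have h2 : ∫⁻ _ in Set.Icc T T', (∞ : ℝ≥0∞) ≤ ∫⁻ t in Set.Icc 0 T',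
          evariance (DeadlineScheduling.totalRemainingDemand job r t) μ :=
        (setLIntegral_mono' measurableSet_Icc fun t ht => (hcon t ht.1).ge).trans
          (lintegral_mono_set (Set.Icc_subset_Icc_left hT))
      rw [setLIntegral_const, Real.volume_Icc, ENNReal.top_mul (by simpa using hTT')] at h2
      exact absurd (h2.trans hT') (by simp)
    exact ne_top_of_le_ne_top
      (DeadlineScheduling.lintegral_totalRate_ne_top hjob hr hf hσ (hT.trans ht) hXt)
      (lintegral_mono_set (Set.Icc_subset_Icc_right ht))
  have ha : 0 ≤ (Λ : ℝ) * ∫ p, p.1 ^ 2 ∂f :=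
    mul_nonneg Λ.coe_nonneg (integral_nonneg fun _ => sq_nonneg _)
  rw [← mul_pow]
  exact DeadlineScheduling.ofReal_sq_div_le_of_energy ha hD hVX hVP hXD fun c hc T hT =>
    DeadlineScheduling.energy_inequality hjob hr hf hσ hT hc (hfinite T hT)
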